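/- **The game $\overline{GHZ}_N$ ($N\ge 1$).** A referee chooses $r\in\{0,1,2,3\}$ and two distinct rounds $i,j\in\{1,\dots,N\}$ uniformly at random, then bits $f_1(i),f_2(i),f_3(i)$ uniformly at random subject to $f_1(i)\oplus f_2(i)\oplus f_3(i)=0$, and, if $r>0$, a uniformly random bit $f_r(j)$. Player $p\in\{1,2,3\}$ (Alice, Bob, Charlie) receives $[i\to f_p(i)]$ if $p\neq r$, and $[i\to f_p(i),\,j\to f_p(j)]$ if $p=r$, and answers $\pm1$ for each round that it is asked about. The game is won if the product of the three answers for round $i$ is $-1$ when $f_1(i)=f_2(i)=f_3(i)=0$ and $+1$ otherwise. (For $N=1$, where there are no two distinct rounds, $r=0$ always, and the game is the GHZ game.) **Strategies.** A *reflection* is a Hermitian operator whose square is the identity. A quantum strategy consists of a unit vector $L\in A\otimes B\otimes C$, where $A,B,C$ are finite-dimensional Hilbert spaces, and, for every $W\in\{A,B,C\}$, all rounds $i,j$ and all bits $b,c$, reflections $R^W_{i\to b}$ and $R^W_{i\to b\mid j\to c}$ on $W$ such that $R^W_{i\to b\mid j\to c}$ and $R^W_{j\to c\mid i\to b}$ commute.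 On the query $[i\to b]$ the player holding $W$ measures $R^W_{i\to b}$; on $[i\to b,\,j\to c]$ it measures $R^W_{i\to b\mid j\to c}$ for its answer on round $i$ and $R^W_{j\to c\mid i\to b}$ for its answer on round $j$. **Isometries.** Let $X'_{W,k}=R^W_{k\to 0}$ and $Z'_{W,k}=R^W_{k\to 1}$. Let $H$ be the Hadamard gate, $\Phi^+=\frac1{\sqrt2}(|00\rangle+|11\rangle)$, and $\mathbf C(U)=|0\rangle\langle0|\otimes I+|1\rangle\langle1|\otimes U$. For qubit registers $\overline Q_k,Q_k$ let $\Psi_{W,k}\colon W\to\overline Q_k\otimes Q_k\otimes W$ prepare $\Phi^+$ on $\overline Q_k\otimes Q_k$ and then apply, in this order, $\mathbf C(X'_{W,k})$, $H$, $\mathbf C(Z'_{W,k})$, $H$, $\mathbf C(X'_{W,k})$, where $H$ acts on $Q_k$ and the controlled gates act on $Q_k\otimes W$ with control $Q_k$. Let $\Theta_{W,N}=\Psi_{W,N}\cdots\Psi_{W,1}$, where each $\Psi_{W,k}$ acts on the $W$ factor and each player has its own $N$ pairs of qubits: $Q_k,\overline Q_k$ for Alice, $Q_{N+k},\overline Q_{N+k}$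 for Bob, $Q_{2N+k},\overline Q_{2N+k}$ for Charlie ($1\le k\le N$). **Theorem.** Let $$|G\rangle=\frac1{2\sqrt2}\Bigl(\sum_{r+s+t\le1}|rst\rangle-\sum_{r+s+t\ge2}|rst\rangle\Bigr),\qquad r,s,t\in\{0,1\}.$$ There is an absolute constant $K>0$ such that for every $N\ge1$ and every quantum strategy that wins $\overline{GHZ}_N$ with probability $1-\epsilon$, the maps $\Theta_{A,N},\Theta_{B,N},\Theta_{C,N}$ are isometries, and there is a unit vector $L'\in A\otimes B\otimes C\otimes\overline Q_1\otimes\cdots\otimes\overline Q_{3N}$ with $$\bigl\|(\Theta_{A,N}\otimes\Theta_{B,N}\otimes\Theta_{C,N})L-|G\rangle^{\otimes N}\otimes L'\bigr\|\le K\,N^4\sqrt{\epsilon},$$ where the $k$-th copy of $|G\rangle$ is on $Q_k\otimes Q_{N+k}\otimes Q_{2N+k}$, and tensor factors are identified up to reordering. -/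

import Mathlib

open scoped Kronecker Matrix

noncomputable section

namespace GHZ

/-! ### Quantum strategies

A finite-dimensional Hilbert space with a fixed orthonormal basis indexed by `α` is
`EuclideanSpace ℂ α`; linear maps between registers are matrices, the tensor product of the
registers indexed by `α` and `β` is the register indexed by `α × β`, and the tensor product of
linear maps is the Kronecker product `⊗ₖ`. -/

/-- A reflection: a Hermitian operator whose square is the identity. -/
structure IsReflection {α : Type*} [Fintype α] [DecidableEq α] (R : Matrix α α ℂ) : Prop where
  isHermitian : R.IsHermitian
  mul_self : R * R = 1

/-- The measurements of one player, holding a register with basis `α`, in the `N`-round game: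
`single i b` is the reflection `R_{i → b}`, used on the one-round query `[i → b]`, and
`pair i b j c` is the reflection `R_{i → b | j → c}`, which on the two-round query
`[i → b, j → c]` gives the answer for round `i`. -/
structure Player (N : ℕ) (α : Type*) [Fintype α] [DecidableEq α] where
  single : Fin N → Bool → Matrix α α ℂ
  pair : Fin N → Bool → Fin N → Bool → Matrix α α ℂ
  single_isReflection : ∀ i b, IsReflection (single i b)
  pair_isReflection : ∀ i b j c, IsReflection (pair i b j c)
  pair_commute : ∀ i b j c, Commute (pair i b j c) (pair j c i b)

/-- A quantum strategy for the augmented GHZ game with `N` rounds: a unit vector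
`L ∈ A ⊗ B ⊗ C` together with the measurements of the three players. -/
structure Strategy (N : ℕ) (α β γ : Type*) [Fintype α] [DecidableEq α]
    [Fintype β] [DecidableEq β] [Fintype γ] [DecidableEq γ] where
  state : EuclideanSpace ℂ (α × β × γ)
  norm_state : ‖state‖ = 1
  alice : Player N α
  bob : Player N β
  charlie : Player N γ

/-! ### The augmented GHZ game -/

/-- A query to one player. Both `single i b` and `pair i b j c` ask for the scored round `i` with
input `b`; the second one asks in addition for round `j` with input `c`. -/
inductive Query (N : ℕ) where
  | single (i : Fin N) (b : Bool)
  | pair (i : Fin N) (b : Bool) (j : Fin N) (c : Bool)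

/-- The choices `(r, i, j, f, c)` of the referee: `f p` is the input for round `i` of player `p`
(the players are numbered `0, 1, 2`), and, if `r = p + 1`, then player `p` is also asked for
round `j` with input `c`. -/
abbrev Choice (N : ℕ) := Fin 4 × Fin N × Fin N × (Fin 3 → Bool) × Bool

/-- The possible choices of the referee: `i` and `j` are distinct and the inputs for round `i` have
even parity. The referee draws uniformly from this set. (When `r = 0`, the values `j` and `c` are
not used. When `N = 1` there is no second round, so that only `r = 0` is possible, and `j` is a
dummy: the game is then the GHZ game itself.) -/
def choices (N : ℕ) : Finset (Choice N) :=
  Finset.univ.filter fun (r, i, j, f, _) =>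
    (i ≠ j ∨ (N = 1 ∧ r = 0)) ∧ (f 0 ^^ f 1 ^^ f 2) = false

/-- The query that player `p` receives. -/
def query {N : ℕ} : Choice N → Fin 3 → Query N
  | (r, i, j, f, c), p => if (r : ℕ) = (p : ℕ) + 1 then .pair i (f p) j c else .single i (f p)

/-- The product of the three answers for round `i` that wins:
`-1` if all three inputs are `0`, and `1` otherwise. -/
def winningSign (f : Fin 3 → Bool) : ℤˣ := if f 0 || f 1 || f 2 then 1 else -1

variable {N : ℕ} {α β γ : Type*} [Fintype α] [DecidableEq α]
  [Fintype β] [DecidableEq β] [Fintype γ] [DecidableEq γ]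

/-- The projection onto the eigenspace of the reflection `R` with eigenvalue `a = ±1`. -/
def eigenProj (R : Matrix α α ℂ) (a : ℤˣ) : Matrix α α ℂ :=
  (1 / 2 : ℂ) • (1 + ((a : ℤ) : ℂ) • R)

/-- The measurement operator for the event that the player, on a given query, answers `a` for the
scored round. On a two-round query the player measures two commuting reflections, and the answer
`d` for the other round is arbitrary. -/
def Player.effect (P : Player N α) : Query N → ℤˣ → Matrix α α ℂ
  | .single i b, a => eigenProj (P.single i b) a
  | .pair i b j c, a => ∑ d : ℤˣ, eigenProj (P.pair i b j c) a * eigenProj (P.pair j c i b) d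

/-- The probability (Born rule) that on the choice `q` of the referee the players answer
`a 0`, `a 1`, `a 2` for the scored round. -/
def Strategy.answerProb (S : Strategy N α β γ) (q : Choice N) (a : Fin 3 → ℤˣ) : ℝ :=
  (inner ℂ S.state (Matrix.toEuclideanLin
    (S.alice.effect (query q 0) (a 0) ⊗ₖ
      (S.bob.effect (query q 1) (a 1) ⊗ₖ S.charlie.effect (query q 2) (a 2))) S.state)).re

/-- The probability that a strategy wins the augmented GHZ game. -/
def Strategy.winProb (S : Strategy N α β γ) : ℝ :=
  (∑ q ∈ choices N, ∑ a : Fin 3 → ℤˣ,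
    if a 0 * a 1 * a 2 = winningSign q.2.2.2.1 then S.answerProb q a else 0) / (choices N).card

/-! ### The swapping isometries -/

/-- The Hadamard gate. -/
def hadamard : Matrix (Fin 2) (Fin 2) ℂ := (1 / (Real.sqrt 2 : ℂ)) • !![1, 1; 1, -1]

/-- The controlled gate `C(U) = |0⟩⟨0| ⊗ I + |1⟩⟨1| ⊗ U`. -/
def ctrl (U : Matrix α α ℂ) : Matrix (Fin 2 × α) (Fin 2 × α) ℂ :=
  !![1, 0; 0, 0] ⊗ₖ 1 + !![0, 0; 0, 1] ⊗ₖ U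

/-- The map `A → Q̄ ⊗ Q ⊗ A`, `v ↦ Φ⁺ ⊗ v`, where `Φ⁺ = (|00⟩ + |11⟩) / √2` is the Bell state. -/
def bellPrep (α : Type*) [DecidableEq α] : Matrix (Fin 2 × Fin 2 × α) α ℂ :=
  Matrix.of fun (s, t, x) y => if s = t ∧ x = y then 1 / (Real.sqrt 2 : ℂ) else 0

/-- The swapping map `Ψ : A → Q̄ ⊗ Q ⊗ A` of a pair of reflections `X`, `Z` on `A`. -/
def swapMap (X Z : Matrix α α ℂ) : Matrix (Fin 2 × Fin 2 × α) α ℂ :=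
  ((1 : Matrix (Fin 2) (Fin 2) ℂ) ⊗ₖ
    (ctrl X * (hadamard ⊗ₖ 1) * ctrl Z * (hadamard ⊗ₖ 1) * ctrl X)) * bellPrep α

/-- The map `Θ_k = Ψ_k ⋯ Ψ_1 : A → (Q̄_1 ⊗ Q_1) ⊗ ⋯ ⊗ (Q̄_k ⊗ Q_k) ⊗ A`, where `Ψ_i` is the swapping
map of the pair `X i`, `Z i`. The first component of `q i` is the basis label of `Q̄_i`, and the
second one that of `Q_i`. -/
def swapChain : (k : ℕ) → (X Z : Fin k → Matrix α α ℂ) →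
    Matrix ((Fin k → Fin 2 × Fin 2) × α) α ℂ
  | 0, _, _ => Matrix.of fun (_, x) y => if x = y then 1 else 0
  | k + 1, X, Z =>
    (((1 : Matrix (Fin k → Fin 2 × Fin 2) (Fin k → Fin 2 × Fin 2) ℂ) ⊗ₖ
        swapMap (X (Fin.last k)) (Z (Fin.last k))) *
      swapChain k (fun i => X i.castSucc) (fun i => Z i.castSucc)).submatrix
        (fun (q, x) => (Fin.init q, (q (Fin.last k)).1, (q (Fin.last k)).2, x)) id

/-- The map `Θ_{W,N}` of a player `W`, built from `X'_i = R_{i → 0}` and `Z'_i = R_{i → 1}`. -/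
def Player.isometry (P : Player N α) : Matrix ((Fin N → Fin 2 × Fin 2) × α) α ℂ :=
  swapChain N (fun i => P.single i false) (fun i => P.single i true)

/-! ### The ideal state -/

/-- The three-qubit state
`|G⟩ = (1 / (2 √2)) (∑_{r + s + t ≤ 1} |r s t⟩ - ∑_{r + s + t ≥ 2} |r s t⟩)`. -/
def stateG : EuclideanSpace ℂ (Fin 2 × Fin 2 × Fin 2) :=
  WithLp.toLp 2 fun (r, s, t) =>
    (if (r : ℕ) + s + t ≤ 1 then 1 else -1) / (2 * (Real.sqrt 2 : ℂ))

/-- The vector `|G⟩^{⊗ N} ⊗ L'`. The `k`-th copy of `|G⟩` is on the `k`-th qubit `Q` of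
Alice, of Bob and of Charlie; `L'` is a vector on `A ⊗ B ⊗ C` and all the qubits `Q̄`. -/
def idealState (N : ℕ) (L' : EuclideanSpace ℂ
      ((α × β × γ) × (Fin N → Fin 2) × (Fin N → Fin 2) × (Fin N → Fin 2))) :
    EuclideanSpace ℂ (((Fin N → Fin 2 × Fin 2) × α) × ((Fin N → Fin 2 × Fin 2) × β) ×
      ((Fin N → Fin 2 × Fin 2) × γ)) :=
  WithLp.toLp 2 fun ((u, x), (v, y), (w, z)) =>
    (∏ k, stateG ((u k).2, (v k).2, (w k).2)) *
      L' ((x, y, z), fun k => (u k).1, fun k => (v k).1, fun k => (w k).1)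

end GHZ

end

/-! Cut along the labels of the added qubits, a swapping isometry is a finite tuple of operators
("blocks"). Errors of isometries become `ℓ²` norms of tuples of vectors in `A ⊗ B ⊗ C`, and
composing with an isometric tuple costs nothing.

Winning with probability `1 - ε` forces every product of three observables, applied to `L`, to be
within `16 N √ε` of `± L`, with the winning sign (`Strategy.norm_observable_sub_le`). Hence one
player's reflection acts on `L` almost like a product of reflections of the other two players. The
signs of the GHZ relations then give approximate anticommutation of `X'_i` and `Z'_i` on `L`; the
two-round queries give approximate commutation between different rounds
(`approxPauli_of_relations`).

These relations hold only on `L`, while the chain of swapping maps needs them on intermediate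
vectors. The remedy is to move a chain acting on `L` to the other players
(`ApproxPauli.l2norm_chainBlock_sub_le`). There it commutes with all operators of the first player,
so that a relation on `L` survives behind the chain with an error linear in its length
(`ApproxPauli.l2norm_apply_chainBlock_le`). Consequently the chain turns `X'_i` into a flip of the
`i`-th label and `Z'_i` into the sign of that label, with error `O(N² δ)`
(`ApproxPauli.l2norm_flip_sub_le`, `ApproxPauli.l2norm_sign_sub_le`).

The state `|G⟩` is fixed by `XZZ`, `ZXZ`, `ZZX`. After multiplication by the signs of `|G⟩^{⊗ N}`,
the blocks of the final state are therefore almost invariant under each of the `3N` label flips.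
Composing flips and averaging over all shifts gives a nearby tuple that does not depend on the
labels of the qubits `Q` (`ApproxGHZ.l2norm_sub_shiftMean_le`). Such a tuple is `|G⟩^{⊗ N}` tensored
with a vector, which is finally normalized. The factors `N` (game), `N²` (chain) and `N` (flips)
make up `N⁴`. -/

noncomputable section

namespace GHZ

/-! ### Tuples of vectors and of operators -/

section Tuples

set_option linter.unusedSectionVars false

variable {E : Type*} [NormedAddCommGroup E] [InnerProductSpace ℂ E]
variable {ι κ : Type*} [Fintype ι] [Fintype κ]

/-- The `ℓ²` norm of a finite tuple of vectors. -/
def l2norm (a : ι → E) : ℝ := ‖(WithLp.toLp 2 a : PiLp 2 fun _ : ι => E)‖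

lemma l2norm_sq (a : ι → E) : l2norm a ^ 2 = ∑ i, ‖a i‖ ^ 2 := by
  simp [l2norm, PiLp.norm_sq_eq_of_L2]

lemma l2norm_nonneg (a : ι → E) : 0 ≤ l2norm a := norm_nonneg _

lemma l2norm_le_of_sq {a : ι → E} {c : ℝ} (hc : 0 ≤ c) (h : ∑ i, ‖a i‖ ^ 2 ≤ c ^ 2) :
    l2norm a ≤ c :=
  le_of_sq_le_sq (by rwa [l2norm_sq]) hc

lemma l2norm_eq_of_sq {a : ι → E} {c : ℝ} (hc : 0 ≤ c) (h : ∑ i, ‖a i‖ ^ 2 = c ^ 2) :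
    l2norm a = c :=
  (sq_eq_sq₀ (l2norm_nonneg _) hc).1 (by rw [l2norm_sq, h])

lemma l2norm_add_le (a b : ι → E) : l2norm (fun i => a i + b i) ≤ l2norm a + l2norm b :=
  norm_add_le (WithLp.toLp 2 a : PiLp 2 fun _ : ι => E) (WithLp.toLp 2 b)

lemma l2norm_sub_le (a b c : ι → E) : l2norm (fun i => a i - c i) ≤
    l2norm (fun i => a i - b i) + l2norm (fun i => b i - c i) := by
  simpa using l2norm_add_le (fun i => a i - b i) (fun i => b i - c i)

lemma l2norm_smul (c : ℂ) (a : ι → E) : l2norm (fun i => c • a i) = ‖c‖ * l2norm a :=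
  norm_smul c (WithLp.toLp 2 a : PiLp 2 fun _ : ι => E)

lemma l2norm_sub_comm (a b : ι → E) :
    l2norm (fun i => a i - b i) = l2norm (fun i => b i - a i) :=
  norm_sub_rev (WithLp.toLp 2 a : PiLp 2 fun _ : ι => E) (WithLp.toLp 2 b)

lemma l2norm_sum_le {σ : Type*} (s : Finset σ) (a : σ → ι → E) :
    l2norm (fun i => ∑ j ∈ s, a j i) ≤ ∑ j ∈ s, l2norm (a j) := by
  have := norm_sum_le s fun j => (WithLp.toLp 2 (a j) : PiLp 2 fun _ : ι => E)
  rw [← WithLp.toLp_sum] at this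
  convert this using 1
  · unfold l2norm
    congr 2
    ext i
    simp
  · rfl

lemma l2norm_equiv (e : κ ≃ ι) (a : ι → E) : l2norm (fun k => a (e k)) = l2norm a :=
  l2norm_eq_of_sq (l2norm_nonneg _)
    (by rw [l2norm_sq]; exact e.sum_comp fun i => ‖a i‖ ^ 2)

/-- The four indices are the label pairs of a single swapping map; `2 = √4`. -/
lemma l2norm_le_of_forall {a : ι → E} {b : ℝ} (hb : 0 ≤ b) (h : ∀ i, ‖a i‖ ≤ b)
    (hι : Fintype.card ι = 4) : l2norm a ≤ 2 * b := by
  refine l2norm_le_of_sq (by positivity) ?_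
  calc ∑ i, ‖a i‖ ^ 2 ≤ ∑ _i : ι, b ^ 2 := by gcongr with i; exact h i
    _ = (2 * b) ^ 2 := by simp [hι]; ring

/-- A tuple of operators `T i` such that `v ↦ (T i v)_i` is an isometry. -/
def IsometricTuple (T : ι → Module.End ℂ E) : Prop := ∀ v, ∑ i, ‖T i v‖ ^ 2 = ‖v‖ ^ 2

/-- A norm-preserving operator. -/
def Preserving (T : Module.End ℂ E) : Prop := ∀ v, ‖T v‖ = ‖v‖

lemma Preserving.mul {S T : Module.End ℂ E} (hS : Preserving S) (hT : Preserving T) :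
    Preserving (S * T) := fun v => by simp [hS _, hT _]

lemma Preserving.one : Preserving (1 : Module.End ℂ E) := fun v => by simp

lemma Preserving.pow {T : Module.End ℂ E} (hT : Preserving T) (n : ℕ) : Preserving (T ^ n) := by
  induction n with
  | zero => exact Preserving.one
  | succ n ih => rw [pow_succ]; exact ih.mul hT

lemma _root_.Commute.end_apply {S T : Module.End ℂ E} (h : Commute S T) (v : E) :
    S (T v) = T (S v) := congr($(h.eq) v)

lemma l2norm_comp_le {T : ι → Module.End ℂ E} {c : ℝ} (hc : 0 ≤ c)
    (hT : ∀ v, l2norm (fun i => T i v) ≤ c * ‖v‖) (a : κ → E) :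
    l2norm (fun p : ι × κ => T p.1 (a p.2)) ≤ c * l2norm a := by
  refine l2norm_le_of_sq (mul_nonneg hc (l2norm_nonneg _)) ?_
  calc ∑ p : ι × κ, ‖T p.1 (a p.2)‖ ^ 2 = ∑ k, l2norm (fun i => T i (a k)) ^ 2 := by
        simp only [Fintype.sum_prod_type_right, l2norm_sq]
    _ ≤ ∑ k, (c * ‖a k‖) ^ 2 :=
        Finset.sum_le_sum fun k _ => pow_le_pow_left₀ (l2norm_nonneg _) (hT _) 2
    _ = (c * l2norm a) ^ 2 := by
        simp only [mul_pow, l2norm_sq, Finset.mul_sum]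

lemma IsometricTuple.l2norm_apply {T : ι → Module.End ℂ E} (hT : IsometricTuple T) (v : E) :
    l2norm (fun i => T i v) = ‖v‖ := l2norm_eq_of_sq (norm_nonneg _) (hT v)

lemma IsometricTuple.l2norm_comp {T : ι → Module.End ℂ E} (hT : IsometricTuple T) (a : κ → E) :
    l2norm (fun p : ι × κ => T p.1 (a p.2)) = l2norm a := by
  refine l2norm_eq_of_sq (l2norm_nonneg _) ?_
  rw [Fintype.sum_prod_type_right, l2norm_sq]
  exact Finset.sum_congr rfl fun k _ => hT (a k)

lemma IsometricTuple.l2norm_comp' {T : ι → Module.End ℂ E} (hT : IsometricTuple T) (a : κ → E) :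
    l2norm (fun p : κ × ι => T p.2 (a p.1)) = l2norm a := by
  rw [← hT.l2norm_comp a, ← l2norm_equiv (Equiv.prodComm κ ι)]
  rfl

lemma IsometricTuple.mul_preserving {T : ι → Module.End ℂ E} (hT : IsometricTuple T)
    {U : Module.End ℂ E} (hU : Preserving U) : IsometricTuple fun i => T i * U :=
  fun v => by simp [hT _, hU v]

lemma IsometricTuple.equiv {T : ι → Module.End ℂ E} (hT : IsometricTuple T) (e : κ ≃ ι) :
    IsometricTuple fun k => T (e k) :=
  fun v => by rw [← hT v]; exact e.sum_comp fun i => ‖T i v‖ ^ 2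

lemma IsometricTuple.mul {T : ι → Module.End ℂ E} {S : κ → Module.End ℂ E}
    (hT : IsometricTuple T) (hS : IsometricTuple S) :
    IsometricTuple fun p : ι × κ => T p.1 * S p.2 := fun v => by
  have := hT.l2norm_comp fun k => S k v
  rw [hS.l2norm_apply] at this
  rw [← this, l2norm_sq]
  rfl

/-- Splitting off the last entry of a tuple. -/
def snocEquiv (k : ℕ) (τ : Type*) : τ × (Fin k → τ) ≃ (Fin (k + 1) → τ) :=
  Fin.snocEquiv fun _ => τ

lemma l2norm_snoc {k : ℕ} {τ : Type*} [Fintype τ] (a : (Fin (k + 1) → τ) → E) :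
    l2norm a = l2norm fun p : τ × (Fin k → τ) => a (Fin.snoc (α := fun _ => τ) p.2 p.1) :=
  (l2norm_equiv (snocEquiv k τ) a).symm

end Tuples

/-! ### The blocks of the swapping maps -/

section Blocks

variable {A : Type*} [Ring A] [Algebra ℂ A]

/-- The block of the swapping map of `X`, `Z` with output labels `q.1` on `Q̄` and `q.2` on `Q`. -/
def swapBlock (X Z : A) (q : Fin 2 × Fin 2) : A :=
  (1 / (2 * (Real.sqrt 2 : ℂ))) •
    (X ^ (q.2 : ℕ) * (1 + (-1 : ℂ) ^ ((q.1 : ℕ) + q.2) • Z) * X ^ (q.1 : ℕ))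

/-- The blocks of the chain of swapping maps of the pairs `R i false`, `R i true`. -/
def chainBlock : (k : ℕ) → (R : Fin k → Bool → A) → (Fin k → Fin 2 × Fin 2) → A
  | 0, _, _ => 1
  | k + 1, R, q => swapBlock (R (Fin.last k) false) (R (Fin.last k) true) (q (Fin.last k)) *
      chainBlock k (fun i => R i.castSucc) (Fin.init q)

/-- The blocks of the chain with the order of all products reversed. -/
def chainBlockRev : (k : ℕ) → (R : Fin k → Bool → A) → (Fin k → Fin 2 × Fin 2) → A
  | 0, _, _ => 1
  | k + 1, R, q => chainBlockRev k (fun i => R i.castSucc) (Fin.init q) *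
      swapBlock (R (Fin.last k) false) (R (Fin.last k) true) (q (Fin.last k)).swap

variable {B : Type*} [Ring B] [Algebra ℂ B]

lemma map_swapBlock (φ : A →ₐ[ℂ] B) (X Z : A) (q : Fin 2 × Fin 2) :
    φ (swapBlock X Z q) = swapBlock (φ X) (φ Z) q := by
  simp [swapBlock]

lemma map_chainBlock (φ : A →ₐ[ℂ] B) {k : ℕ} (R : Fin k → Bool → A) (q : Fin k → Fin 2 × Fin 2) :
    φ (chainBlock k R q) = chainBlock k (fun i b => φ (R i b)) q := by
  induction k with
  | zero => simp [chainBlock]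
  | succ k ih => simp [chainBlock, map_swapBlock, ih]

lemma Commute.swapBlock_right {M X Z : A} (hX : Commute M X) (hZ : Commute M Z)
    (q : Fin 2 × Fin 2) : Commute M (swapBlock X Z q) :=
  (((hX.pow_right _).mul_right ((Commute.one_right _).add_right (hZ.smul_right _))).mul_right
    (hX.pow_right _)).smul_right _

lemma Commute.chainBlock_right {k : ℕ} {M : A} {R : Fin k → Bool → A}
    (h : ∀ i b, Commute M (R i b)) (q : Fin k → Fin 2 × Fin 2) :
    Commute M (chainBlock k R q) := by
  induction k with
  | zero => exact Commute.one_right _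
  | succ k ih =>
    exact (Commute.swapBlock_right (h _ _) (h _ _) _).mul_right (ih (fun i b => h _ b) _)

lemma Commute.chainBlockRev_right {k : ℕ} {M : A} {R : Fin k → Bool → A}
    (h : ∀ i b, Commute M (R i b)) (q : Fin k → Fin 2 × Fin 2) :
    Commute M (chainBlockRev k R q) := by
  induction k with
  | zero => exact Commute.one_right _
  | succ k ih =>
    exact (ih (fun i b => h _ b) _).mul_right (Commute.swapBlock_right (h _ _) (h _ _) _)

end Blocks

/-! ### Block tuples of norm-preserving operators are isometric -/

section Isometric

variable {E : Type*} [NormedAddCommGroup E] [InnerProductSpace ℂ E]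

lemma swapBlock_apply (X Z : Module.End ℂ E) (q : Fin 2 × Fin 2) (v : E) :
    swapBlock X Z q v = (1 / (2 * (Real.sqrt 2 : ℂ))) • (X ^ (q.2 : ℕ))
      ((X ^ (q.1 : ℕ)) v + (-1 : ℂ) ^ ((q.1 : ℕ) + q.2) • Z ((X ^ (q.1 : ℕ)) v)) := by
  simp [swapBlock]

lemma isometricTuple_swapBlock {X Z : Module.End ℂ E} (hX : Preserving X) (hZ : Preserving Z) :
    IsometricTuple (swapBlock X Z) := fun v => by
  -- For fixed `q.1`, the two values of `q.2` produce the two signs, so the parallelogram law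
  -- suffices: neither `X² = 1` nor hermiticity enters.
  have key : ∀ w : E, ‖w + Z w‖ ^ 2 + ‖w - Z w‖ ^ 2 = 4 * ‖w‖ ^ 2 := fun w => by
    have := parallelogram_law_with_norm ℂ w (Z w)
    rw [hZ w] at this
    nlinarith
  have h1 := key v
  have h2 := key (X v)
  rw [hX v] at h2
  simp only [Fintype.sum_prod_type, Fin.sum_univ_two, swapBlock_apply, norm_smul, mul_pow,
    hX.pow _ _]
  have hs : (√2 : ℝ) ^ 2 = 2 := Real.sq_sqrt (by norm_num)
  simp only [norm_div, norm_mul, Complex.norm_real, norm_one, div_pow, mul_pow, Complex.norm_ofNat,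
    Real.norm_eq_abs, sq_abs, hs]
  simp [← sub_eq_add_neg]
  linarith

lemma isometricTuple_chainBlock {k : ℕ} {R : Fin k → Bool → Module.End ℂ E}
    (hR : ∀ i b, Preserving (R i b)) : IsometricTuple (chainBlock k R) := by
  induction k with
  | zero => exact fun v => by simp [chainBlock]
  | succ k ih =>
    have := ((isometricTuple_swapBlock (hR (Fin.last k) false) (hR (Fin.last k) true)).mul
      (ih fun i b => hR i.castSucc b)).equiv (snocEquiv k _).symm
    exact this

lemma isometricTuple_chainBlockRev {k : ℕ} {R : Fin k → Bool → Module.End ℂ E}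
    (hR : ∀ i b, Preserving (R i b)) : IsometricTuple (chainBlockRev k R) := by
  induction k with
  | zero => exact fun v => by simp [chainBlockRev]
  | succ k ih =>
    have := ((ih fun i b => hR i.castSucc b).mul ((isometricTuple_swapBlock (hR (Fin.last k) false)
      (hR (Fin.last k) true)).equiv (Equiv.prodComm _ _))).equiv
        ((snocEquiv k _).symm.trans (Equiv.prodComm _ _))
    exact this

end Isometric

/-! ### Approximate relations for a single player -/

section OnePlayer

variable {E : Type*} [NormedAddCommGroup E] [InnerProductSpace ℂ E]

lemma norm_swapBlock_const_le : ‖(1 / (2 * (Real.sqrt 2 : ℂ)))‖ ≤ 1 / 2 := by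
  have h : (1 : ℝ) ≤ √2 := by simp
  rw [norm_div, norm_mul, Complex.norm_real, norm_one, Complex.norm_ofNat, Real.norm_eq_abs,
    abs_of_nonneg (by positivity)]
  gcongr
  linarith

/-- If `XZ = -ZX`, then `X(1 - ηZ) = (1 + ηZ)X`, and the two sides agree exactly. In general one
anticommutator appears, up to a norm-preserving factor. -/
lemma norm_swapBlock_flip_le {X Z : Module.End ℂ E} (hX : Preserving X) (hXX : X * X = 1)
    (q : Fin 2 × Fin 2) (w : E) :
    ‖swapBlock X Z (q.1, q.2 + 1) w - swapBlock X Z q (X w)‖ ≤ 1 / 2 * ‖X (Z w) + Z (X w)‖ := by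
  have hXv : ∀ v, X (X v) = v := fun v => congr($hXX v)
  have h1 : ∀ v : E, ‖v‖ = ‖X (Z w) + Z (X w)‖ →
      ‖(1 / (2 * (Real.sqrt 2 : ℂ))) • v‖ ≤ 1 / 2 * ‖X (Z w) + Z (X w)‖ := fun v hv => by
    rw [norm_smul, hv]
    gcongr
    exact norm_swapBlock_const_le
  obtain ⟨s, t⟩ := q
  rw [swapBlock_apply, swapBlock_apply, ← smul_sub]
  apply h1
  fin_cases s <;> fin_cases t
  · rw [← norm_neg]; congr 1; simp; abel
  · rw [← hX (X (Z w) + Z (X w))]; congr 1; simp [hXv]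
  · rw [← hX (X (Z w) + Z (X w))]; congr 1; simp [hXv]; abel
  · rw [← norm_neg]; congr 1; simp [hXv]

/-- The factor `1 + ηZ` absorbs `Z`, since `(1 + ηZ)Z = η(1 + ηZ)` for `η = ±1`. The anticommutator
is needed only to carry `Z` past `X` when `q.1 = 1`. -/
lemma norm_swapBlock_sign_le {X Z : Module.End ℂ E} (hX : Preserving X) (hZ : Preserving Z)
    (hZZ : Z * Z = 1) (q : Fin 2 × Fin 2) (w : E) :
    ‖(-1 : ℂ) ^ (q.2 : ℕ) • swapBlock X Z q w - swapBlock X Z q (Z w)‖ ≤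
      ‖X (Z w) + Z (X w)‖ := by
  have hZv : ∀ v, Z (Z v) = v := fun v => congr($hZZ v)
  set a := X (Z w) + Z (X w) with ha
  have h1 : ∀ v : E, ‖v‖ ≤ 2 * ‖a‖ →
      ‖(1 / (2 * (Real.sqrt 2 : ℂ))) • v‖ ≤ ‖a‖ := fun v hv => by
    rw [norm_smul]
    calc _ ≤ 1 / 2 * (2 * ‖a‖) := by gcongr; exact norm_swapBlock_const_le
      _ = ‖a‖ := by ring
  have h2 : ‖a + Z a‖ ≤ 2 * ‖a‖ := (norm_add_le _ _).trans (by rw [hZ]; linarith)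
  have h3 : ‖a - Z a‖ ≤ 2 * ‖a‖ := (norm_sub_le _ _).trans (by rw [hZ]; linarith)
  obtain ⟨s, t⟩ := q
  rw [swapBlock_apply, swapBlock_apply, smul_comm, ← smul_sub]
  apply h1
  fin_cases s <;> fin_cases t
  · simp [hZv, add_comm]
  · refine le_trans (le_of_eq ?_) (norm_nonneg (a - a) |>.trans (by simp))
    simp [hZv]
    abel
  · refine le_trans (le_of_eq ?_) h3
    rw [← norm_neg]; congr 1; simp [hZv, ha]; abel
  · refine le_trans (le_of_eq ?_) h2
    rw [← hX (a + Z a), ← norm_neg]; congr 1; simp [hZv, ha]; abel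

/-- The letter next to `L` is exchanged for its primed partner, which then slides out to the left;
repeating this reverses the word. The cost is `2δ` for `Q`, `δ` for `Z` and `2δ` for `P`. -/
lemma norm_word_sub_le {P Z Q P' Z' Q' : Module.End ℂ E} {η : ℂ} {L : E} {δ : ℝ}
    (hη : ‖η‖ = 1) (hP : Preserving P) (hZ : Preserving Z) (hQ' : Preserving Q')
    (hZ' : Preserving Z') (hPQ : Commute P Q') (hZQ : Commute Z Q') (hPZ : Commute P Z')
    (h1 : ‖P L - P' L‖ ≤ δ) (h2 : ‖Z L - Z' L‖ ≤ δ) (h3 : ‖Q L - Q' L‖ ≤ δ) :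
    ‖P (Q L + η • Z (Q L)) - Q' (P' L + η • Z' (P' L))‖ ≤ 5 * δ := by
  have e : P (Q L + η • Z (Q L)) - Q' (P' L + η • Z' (P' L)) =
      P ((Q L - Q' L) + η • Z (Q L - Q' L)) + (Q' (P (η • (Z L - Z' L))) +
        Q' ((P L - P' L) + η • Z' (P L - P' L))) := by
    simp only [map_add, map_sub, map_smul, smul_sub, hPQ.end_apply, hZQ.end_apply, hPZ.end_apply]
    abel
  rw [e]
  have t1 : ∀ v w : E, ‖v‖ ≤ δ → ‖w‖ ≤ δ → ‖v + η • w‖ ≤ 2 * δ := fun v w hv hw => by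
    refine (norm_add_le _ _).trans ?_
    rw [norm_smul, hη]
    linarith
  refine (norm_add_le _ _).trans ((add_le_add le_rfl (norm_add_le _ _)).trans ?_)
  rw [hP, hQ', hP, hQ', norm_smul, hη]
  have := t1 _ _ h3 ((hZ _).trans_le h3)
  have := t1 _ _ h1 ((hZ' _).trans_le h1)
  linarith

/-- Since `K Q L ≈ K Q' L = Q' K L`, smallness of `K` on `L` passes to `Q L`. -/
lemma norm_apply_le_add {K Q Q' : Module.End ℂ E} {L : E} {c δ : ℝ} (hc : 0 ≤ c)
    (hK : ∀ v, ‖K v‖ ≤ c * ‖v‖) (hKQ : Commute K Q') (hQ' : Preserving Q')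
    (h : ‖Q L - Q' L‖ ≤ δ) : ‖K (Q L)‖ ≤ ‖K L‖ + c * δ := by
  have e : K (Q L) = Q' (K L) + K (Q L - Q' L) := by
    rw [map_sub, hKQ.end_apply]; abel
  rw [e]
  refine (norm_add_le _ _).trans ?_
  rw [hQ']
  gcongr
  exact (hK _).trans (by gcongr)

lemma norm_commutator_word_le {M P Z Q Z' Q' : Module.End ℂ E} {η : ℂ} {L : E} {δ : ℝ}
    (hη : ‖η‖ = 1) (hM : Preserving M) (hP : Preserving P) (hZ : Preserving Z)
    (hQ' : Preserving Q') (hZ' : Preserving Z') (hMQ : Commute M Q') (hMZ : Commute M Z')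
    (hPQ : Commute P Q') (hPZ : Commute P Z') (hZQ : Commute Z Q')
    (h2 : ‖Z L - Z' L‖ ≤ δ) (h3 : ‖Q L - Q' L‖ ≤ δ) (c1 : ‖M (P L) - P (M L)‖ ≤ δ)
    (c2 : ‖M (Z L) - Z (M L)‖ ≤ δ) (c3 : ‖M (Q L) - Q (M L)‖ ≤ δ) :
    ‖M (P (Q L + η • Z (Q L))) - P (Q (M L) + η • Z (Q (M L)))‖ ≤ 13 * δ := by
  have bd : ∀ {S : Module.End ℂ E}, Preserving S → ∀ v, ‖(M * S - S * M) v‖ ≤ 2 * ‖v‖ :=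
    fun {S} hS v => by
      refine (norm_sub_le _ _).trans ?_
      simp only [Module.End.mul_apply, hM _, hS _]
      linarith
  have a1 := norm_apply_le_add zero_le_two (bd hP)
    ((hMQ.mul_left hPQ).sub_left (hPQ.mul_left hMQ)) hQ' h3
  have a2 := norm_apply_le_add zero_le_two (bd hZ)
    ((hMQ.mul_left hZQ).sub_left (hZQ.mul_left hMQ)) hQ' h3
  have a3 := norm_apply_le_add (K := (M * P - P * M) * Z) zero_le_two
    (fun v => (bd hP _).trans_eq (by rw [hZ]))
    (((hMQ.mul_left hPQ).sub_left (hPQ.mul_left hMQ)).mul_left hZQ) hQ' h3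
  have a4 := norm_apply_le_add zero_le_two (bd hP)
    ((hMZ.mul_left hPZ).sub_left (hPZ.mul_left hMZ)) hZ' h2
  simp only [Module.End.mul_apply, LinearMap.sub_apply] at a1 a2 a3 a4
  have e : M (P (Q L + η • Z (Q L))) - P (Q (M L) + η • Z (Q (M L))) =
      (M (P (Q L)) - P (M (Q L))) + η • (M (P (Z (Q L))) - P (M (Z (Q L)))) +
      η • P (M (Z (Q L)) - Z (M (Q L))) +
      (P (M (Q L) - Q (M L)) + η • P (Z (M (Q L) - Q (M L)))) := by
    simp only [map_add, map_sub, map_smul, smul_sub]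
    abel
  rw [e]
  refine (norm_add_le _ _).trans ((add_le_add (norm_add₃_le) (norm_add_le _ _)).trans ?_)
  simp only [norm_smul, hη, hP _, hZ _, one_mul]
  linarith

lemma norm_swapBlock_le_of_word {v : E} {b : ℝ} (h : ‖v‖ ≤ b) :
    ‖(1 / (2 * (Real.sqrt 2 : ℂ))) • v‖ ≤ 1 / 2 * b := by
  rw [norm_smul]
  exact mul_le_mul norm_swapBlock_const_le h (norm_nonneg _) (by norm_num)

/-- The relations which the reflections `R i false`, `R i true` of one player approximately
satisfy on the state `L`. The operators `R'` act on the registers of the other players. -/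
structure ApproxPauli {k : ℕ} (R R' : Fin k → Bool → Module.End ℂ E) (L : E) (δ : ℝ) : Prop where
  nonneg : 0 ≤ δ
  preserving : ∀ i b, Preserving (R i b)
  preserving' : ∀ i b, Preserving (R' i b)
  mul_self : ∀ i b, R i b * R i b = 1
  commute : ∀ i b j c, Commute (R i b) (R' j c)
  close : ∀ i b, ‖R i b L - R' i b L‖ ≤ δ
  anticomm : ∀ i, ‖R i false (R i true L) + R i true (R i false L)‖ ≤ δ
  comm : ∀ i j, i ≠ j → ∀ b c, ‖R i b (R j c L) - R j c (R i b L)‖ ≤ δ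

/-- Flipping the label of the `i`-th qubit `Q`. -/
def flipBit {k : ℕ} (i : Fin k) (q : Fin k → Fin 2 × Fin 2) : Fin k → Fin 2 × Fin 2 :=
  Function.update q i ((q i).1, (q i).2 + 1)

namespace ApproxPauli

variable {k : ℕ} {L : E} {δ : ℝ}

lemma castSucc {R R' : Fin (k + 1) → Bool → Module.End ℂ E} (h : ApproxPauli R R' L δ) :
    ApproxPauli (fun i => R i.castSucc) (fun i => R' i.castSucc) L δ where
  nonneg := h.nonneg
  preserving i := h.preserving _
  preserving' i := h.preserving' _
  mul_self i := h.mul_self _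
  commute i b j := h.commute _ b _
  close i := h.close _
  anticomm i := h.anticomm _
  comm i j hij := h.comm _ _ (by simpa using hij)

variable {R R' : Fin k → Bool → Module.End ℂ E}

lemma close_pow (h : ApproxPauli R R' L δ) (i : Fin k) (b : Bool) (s : Fin 2) :
    ‖(R i b ^ (s : ℕ)) L - (R' i b ^ (s : ℕ)) L‖ ≤ δ := by
  fin_cases s
  · simpa using h.nonneg
  · simpa using h.close i b

lemma l2norm_swapBlock_sub_le (h : ApproxPauli R R' L δ) (i : Fin k) :
    l2norm (fun q : Fin 2 × Fin 2 => swapBlock (R i false) (R i true) q L -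
      swapBlock (R' i false) (R' i true) q.swap L) ≤ 5 * δ := by
  have := h.nonneg
  refine (l2norm_le_of_forall (b := 1 / 2 * (5 * δ)) (by positivity) (fun q => ?_) rfl).trans_eq
    (by ring)
  rw [swapBlock_apply, swapBlock_apply, ← smul_sub]
  apply norm_swapBlock_le_of_word
  simp only [Prod.fst_swap, Prod.snd_swap, add_comm (q.2 : ℕ)]
  exact norm_word_sub_le (by simp) ((h.preserving _ _).pow _) (h.preserving _ _)
    ((h.preserving' _ _).pow _) (h.preserving' _ _) ((h.commute _ _ _ _).pow_pow _ _)
    ((h.commute _ _ _ _).pow_right _) ((h.commute _ _ _ _).pow_left _) (h.close_pow _ _ _)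
    (h.close _ _) (h.close_pow _ _ _)

lemma l2norm_swapBlock_commutator_le (h : ApproxPauli R R' L δ) (i : Fin k) {M : Module.End ℂ E}
    (hM : Preserving M) (hMR : ∀ i b, Commute M (R' i b))
    (hc : ∀ b, ‖M (R i b L) - R i b (M L)‖ ≤ δ) :
    l2norm (fun q : Fin 2 × Fin 2 => M (swapBlock (R i false) (R i true) q L) -
      swapBlock (R i false) (R i true) q (M L)) ≤ 13 * δ := by
  have h0 := h.nonneg
  refine (l2norm_le_of_forall (b := 1 / 2 * (13 * δ)) (by positivity) (fun q => ?_) rfl).trans_eq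
    (by ring)
  have hp : ∀ s : Fin 2, ‖M ((R i false ^ (s : ℕ)) L) - (R i false ^ (s : ℕ)) (M L)‖ ≤ δ := by
    intro s
    fin_cases s
    · simpa using h0
    · simpa using hc false
  rw [swapBlock_apply, swapBlock_apply, map_smul, ← smul_sub]
  apply norm_swapBlock_le_of_word
  exact norm_commutator_word_le (by simp) hM ((h.preserving _ _).pow _) (h.preserving _ _)
    ((h.preserving' _ _).pow _) (h.preserving' _ _) ((hMR _ _).pow_right _) (hMR _ _)
    ((h.commute _ _ _ _).pow_pow _ _) ((h.commute _ _ _ _).pow_left _)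
    ((h.commute _ _ _ _).pow_right _) (h.close _ _) (h.close_pow _ _ _) (hp _) (hc _) (hp _)

/-- Each block next to `L` moves to the other players and slides outwards, which explains the
reversed order and the swapped labels in `chainBlockRev`. Isometry of the remaining blocks keeps the
errors additive. -/
lemma l2norm_chainBlock_sub_le (h : ApproxPauli R R' L δ) :
    l2norm (fun q => chainBlock k R q L - chainBlockRev k R' q L) ≤ 5 * k * δ := by
  induction k with
  | zero => exact l2norm_le_of_sq (by simp) (by simp [chainBlock, chainBlockRev])
  | succ k ih =>
    rw [l2norm_snoc]
    simp only [chainBlock, chainBlockRev, Fin.snoc_last, Fin.init_snoc, Module.End.mul_apply]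
    refine (l2norm_sub_le _ (fun p => swapBlock (R (Fin.last k) false) (R (Fin.last k) true) p.1
      (chainBlockRev k (fun i => R' i.castSucc) p.2 L)) _).trans ?_
    have t1 := (isometricTuple_swapBlock (h.preserving (Fin.last k) false)
      (h.preserving (Fin.last k) true)).l2norm_comp (fun q => chainBlock k (fun i => R i.castSucc) q L -
        chainBlockRev k (fun i => R' i.castSucc) q L)
    have t2 := (isometricTuple_chainBlockRev fun i b => h.preserving' (Fin.castSucc i) b).l2norm_comp'
      (fun q => swapBlock (R (Fin.last k) false) (R (Fin.last k) true) q L -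
        swapBlock (R' (Fin.last k) false) (R' (Fin.last k) true) q.swap L)
    have hcm : ∀ q q', Commute (swapBlock (R (Fin.last k) false) (R (Fin.last k) true) q)
        (chainBlockRev k (fun i => R' i.castSucc) q') := fun q q' =>
      Commute.chainBlockRev_right (fun i b => (Commute.swapBlock_right (h.commute _ _ _ _).symm
        (h.commute _ _ _ _).symm _).symm) _
    simp only [map_sub] at t1 t2
    simp only [(hcm _ _).end_apply] at t1 ⊢
    rw [t1, t2]
    push_cast
    linarith [ih h.castSucc, h.l2norm_swapBlock_sub_le (Fin.last k)]

/-- The transport principle: once the chain is moved to the other players it commutes with `M` and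
preserves norms, so an estimate for `M` on `L` holds behind the chain as well. -/
lemma l2norm_apply_chainBlock_le (h : ApproxPauli R R' L δ) {ι : Type*} [Fintype ι]
    {M : ι → Module.End ℂ E} {c : ℝ} (hc : 0 ≤ c) (hM : ∀ v, l2norm (fun i => M i v) ≤ c * ‖v‖)
    (hMR : ∀ m i b, Commute (M m) (R' i b)) :
    l2norm (fun p : ι × (Fin k → Fin 2 × Fin 2) => M p.1 (chainBlock k R p.2 L)) ≤
      l2norm (fun i => M i L) + c * (5 * k * δ) := by
  have t1 := l2norm_comp_le hc hM fun q => chainBlock k R q L - chainBlockRev k R' q L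
  have t2 := (isometricTuple_chainBlockRev h.preserving').l2norm_comp' fun i => M i L
  have t3 := l2norm_add_le
    (fun p : ι × (Fin k → Fin 2 × Fin 2) => chainBlockRev k R' p.2 (M p.1 L))
    (fun p => M p.1 (chainBlock k R p.2 L - chainBlockRev k R' p.2 L))
  simp only [map_sub, (Commute.chainBlockRev_right (hMR _) _).end_apply, add_sub_cancel] at t1 t2 t3
  exact t3.trans (add_le_add t2.le (t1.trans (by gcongr; exact h.l2norm_chainBlock_sub_le)))

lemma l2norm_chainBlock_commutator_le (h : ApproxPauli R R' L δ) {M : Module.End ℂ E}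
    (hM : Preserving M) (hMR : ∀ i b, Commute M (R' i b))
    (hc : ∀ i b, ‖M (R i b L) - R i b (M L)‖ ≤ δ) :
    l2norm (fun q => M (chainBlock k R q L) - chainBlock k R q (M L)) ≤
      (13 * k + 5 * k ^ 2) * δ := by
  induction k with
  | zero => exact l2norm_le_of_sq (by simp) (by simp [chainBlock])
  | succ k ih =>
    rw [l2norm_snoc]
    set ψ := swapBlock (R (Fin.last k) false) (R (Fin.last k) true) with hψ
    have iso : IsometricTuple ψ := isometricTuple_swapBlock (h.preserving _ _) (h.preserving _ _)
    simp only [chainBlock, Fin.snoc_last, Fin.init_snoc, Module.End.mul_apply, ← hψ]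
    -- Commuting `M` with the last block happens behind a chain of length `k`, hence costs `13δ + 2
    -- · 5kδ` by transport; summing over the blocks gives the quadratic bound.
    refine (l2norm_sub_le _ (fun p => ψ p.1
      (M (chainBlock k (fun i => R i.castSucc) p.2 L))) _).trans ?_
    have t1 := iso.l2norm_comp (fun q => M (chainBlock k (fun i => R i.castSucc) q L) -
        chainBlock k (fun i => R i.castSucc) q (M L))
    have t2 := h.castSucc.l2norm_apply_chainBlock_le (M := fun q => M * ψ q - ψ q * M) zero_le_two
      (fun v => by
        have e := (l2norm_sub_le (fun q => (M * ψ q) v) (fun _ => 0) (fun q => (ψ q * M) v))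
        have e1 : l2norm (fun q => M (ψ q v)) = ‖v‖ :=
          l2norm_eq_of_sq (norm_nonneg _) (by simp [hM _, iso v])
        rw [l2norm_sub_comm (fun _ => 0)] at e
        simp only [sub_zero, Module.End.mul_apply, e1, iso.l2norm_apply, hM v] at e
        simp only [LinearMap.sub_apply, Module.End.mul_apply]
        linarith)
      (fun q i b => by
        have := (Commute.swapBlock_right (h.commute (Fin.last k) false i.castSucc b).symm
          (h.commute (Fin.last k) true i.castSucc b).symm q).symm
        exact ((hMR _ _).mul_left this).sub_left (this.mul_left (hMR _ _)))
    have t3 := h.l2norm_swapBlock_commutator_le (Fin.last k) hM hMR (hc _)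
    have t4 := ih h.castSucc (fun i b => hMR _ _) (fun i b => hc _ _)
    simp only [map_sub, LinearMap.sub_apply, Module.End.mul_apply] at t1 t2
    rw [← hψ] at t3
    push_cast
    have := h.nonneg
    nlinarith

/-- Common core of the flip and sign estimates for the last qubit. The last block converts `S` into
`R (Fin.last k) b` by anticommutation, transported behind the shorter chain; that reflection is then
commuted through the shorter chain. -/
lemma l2norm_snoc_sub_le {R R' : Fin (k + 1) → Bool → Module.End ℂ E} (h : ApproxPauli R R' L δ)
    (b : Bool) {S : Fin 2 × Fin 2 → Module.End ℂ E}
    (hS : ∀ q w, ‖S q w - swapBlock (R (Fin.last k) false) (R (Fin.last k) true) q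
      (R (Fin.last k) b w)‖ ≤ ‖R (Fin.last k) false (R (Fin.last k) true w) +
        R (Fin.last k) true (R (Fin.last k) false w)‖) :
    l2norm (fun q : Fin (k + 1) → Fin 2 × Fin 2 =>
      S (q (Fin.last k)) (chainBlock k (fun i => R i.castSucc) (Fin.init q) L) -
        chainBlock (k + 1) R q (R (Fin.last k) b L)) ≤ 40 * (k + 1) ^ 2 * δ := by
  rw [l2norm_snoc]
  set ψ := swapBlock (R (Fin.last k) false) (R (Fin.last k) true) with hψ
  set X := R (Fin.last k) false with hX
  set Z := R (Fin.last k) true with hZ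
  have pX : Preserving X := h.preserving _ _
  have pZ : Preserving Z := h.preserving _ _
  have iso : IsometricTuple ψ := isometricTuple_swapBlock pX pZ
  simp only [chainBlock, Fin.snoc_last, Fin.init_snoc, Module.End.mul_apply, ← hψ, ← hX, ← hZ]
  refine (l2norm_sub_le _ (fun p => ψ p.1
    (R (Fin.last k) b (chainBlock k (fun i => R i.castSucc) p.2 L))) _).trans ?_
  have t1 := iso.l2norm_comp (fun q => R (Fin.last k) b
    (chainBlock k (fun i => R i.castSucc) q L) -
      chainBlock k (fun i => R i.castSucc) q (R (Fin.last k) b L))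
  simp only [map_sub] at t1
  rw [t1]
  have t2 := h.castSucc.l2norm_chainBlock_commutator_le (h.preserving (Fin.last k) b)
    (fun i c => h.commute _ _ _ _) (fun i c => h.comm _ _ (Fin.castSucc_lt_last i).ne' _ _)
  have bd : ∀ v, ‖(X * Z + Z * X) v‖ ≤ 2 * ‖v‖ := fun v => by
    refine (norm_add_le _ _).trans ?_
    simp only [Module.End.mul_apply, pX _, pZ _]
    linarith
  have hl : ∀ v : E, l2norm (fun _ : Unit => v) = ‖v‖ := fun v =>
    l2norm_eq_of_sq (norm_nonneg _) (by simp)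
  have t3 := h.castSucc.l2norm_apply_chainBlock_le (M := fun _ : Unit => X * Z + Z * X)
    zero_le_two (fun v => by rw [hl]; exact bd v)
    (fun _ i c => ((h.commute _ _ _ _).mul_left (h.commute _ _ _ _)).add_left
      ((h.commute _ _ _ _).mul_left (h.commute _ _ _ _)))
  rw [hl, ← l2norm_equiv (Equiv.punitProd _).symm] at t3
  have t4 := h.anticomm (Fin.last k)
  -- The bound `hS` does not depend on the four labels of the last block, hence the factor `2 = √4`.
  have t5 : l2norm (fun p : (Fin 2 × Fin 2) × (Fin k → Fin 2 × Fin 2) =>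
      S p.1 (chainBlock k (fun i => R i.castSucc) p.2 L) -
        ψ p.1 (R (Fin.last k) b (chainBlock k (fun i => R i.castSucc) p.2 L))) ≤
      2 * l2norm (fun q => (X * Z + Z * X) (chainBlock k (fun i => R i.castSucc) q L)) := by
    refine l2norm_le_of_sq (mul_nonneg zero_le_two (l2norm_nonneg _)) ?_
    rw [mul_pow, l2norm_sq, Fintype.sum_prod_type]
    refine (Finset.sum_le_sum fun q _ => Finset.sum_le_sum fun q' _ =>
      pow_le_pow_left₀ (norm_nonneg _) (hS _ _) 2).trans_eq ?_
    simp
    norm_num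
  simp only [Equiv.punitProd_symm_apply, LinearMap.add_apply, Module.End.mul_apply] at t3 t4 t5
  have := h.nonneg
  rw [← hX, ← hZ] at t4
  have h6 : 0 ≤ (k : ℝ) * δ := by positivity
  have h7 : 0 ≤ (k : ℝ) ^ 2 * δ := by positivity
  -- The total is `(2 + 33 k + 5 k²) δ`.
  nlinarith

lemma l2norm_flip_sub_le (h : ApproxPauli R R' L δ) (i : Fin k) :
    l2norm (fun q => chainBlock k R (flipBit i q) L - chainBlock k R q (R i false L)) ≤
      40 * k ^ 2 * δ := by
  induction k with
  | zero => exact i.elim0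
  | succ k ih =>
    have h0 := h.nonneg
    cases i using Fin.lastCases with
    | last =>
      have := h.l2norm_snoc_sub_le false
        (S := fun q => swapBlock (R (Fin.last k) false) (R (Fin.last k) true) (q.1, q.2 + 1))
        fun q w => (norm_swapBlock_flip_le (h.preserving _ _) (h.mul_self _ _) q w).trans
          (mul_le_of_le_one_left (norm_nonneg _) (by norm_num))
      push_cast
      refine le_trans (le_of_eq ?_) this
      simp [chainBlock, flipBit, Fin.init_update_last]
    -- An earlier qubit is unaffected by the last block, which is isometric, so the error does not
    -- grow.
    | cast i =>
      have t1 := (isometricTuple_swapBlock (h.preserving (Fin.last k) false)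
        (h.preserving (Fin.last k) true)).l2norm_comp (fun q =>
          chainBlock k (fun i => R i.castSucc) (flipBit i q) L -
            chainBlock k (fun i => R i.castSucc) q (R i.castSucc false L))
      have t2 := ih h.castSucc i
      rw [← t1] at t2
      rw [l2norm_snoc]
      have e : ∀ p : (Fin 2 × Fin 2) × (Fin k → Fin 2 × Fin 2),
          flipBit i.castSucc (Fin.snoc (α := fun _ => Fin 2 × Fin 2) p.2 p.1) =
            Fin.snoc (α := fun _ => Fin 2 × Fin 2) (flipBit i p.2) p.1 := fun p => by
        rw [flipBit, flipBit, Fin.snoc_update]; simp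
      simp only [e, chainBlock, Fin.snoc_last, Fin.init_snoc, Module.End.mul_apply, map_sub] at t2 ⊢
      refine t2.trans ?_
      gcongr
      simp

lemma l2norm_sign_sub_le (h : ApproxPauli R R' L δ) (i : Fin k) :
    l2norm (fun q => (-1 : ℂ) ^ ((q i).2 : ℕ) • chainBlock k R q L -
      chainBlock k R q (R i true L)) ≤ 40 * k ^ 2 * δ := by
  induction k with
  | zero => exact i.elim0
  | succ k ih =>
    have h0 := h.nonneg
    cases i using Fin.lastCases with
    | last =>
      have := h.l2norm_snoc_sub_le true (S := fun q => (-1 : ℂ) ^ (q.2 : ℕ) •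
          swapBlock (R (Fin.last k) false) (R (Fin.last k) true) q)
        fun q w => norm_swapBlock_sign_le (h.preserving _ _) (h.preserving _ _) (h.mul_self _ _) q w
      push_cast
      refine le_trans (le_of_eq ?_) this
      simp [chainBlock]
    | cast i =>
      have t1 := (isometricTuple_swapBlock (h.preserving (Fin.last k) false)
        (h.preserving (Fin.last k) true)).l2norm_comp (fun q =>
          (-1 : ℂ) ^ ((q i).2 : ℕ) • chainBlock k (fun i => R i.castSucc) q L -
            chainBlock k (fun i => R i.castSucc) q (R i.castSucc true L))
      have t2 := ih h.castSucc i
      rw [← t1] at t2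
      rw [l2norm_snoc]
      simp only [chainBlock, Fin.snoc_last, Fin.snoc_castSucc, Fin.init_snoc, Module.End.mul_apply,
        map_sub, map_smul] at t2 ⊢
      refine t2.trans ?_
      gcongr
      simp

end ApproxPauli

end OnePlayer

/-! ### Three players -/

section ThreePlayers

variable {E : Type*} [NormedAddCommGroup E] [InnerProductSpace ℂ E]

/-- The product of the answers that wins on the inputs `a`, `b`, `c`. -/
def inputSign (a b c : Bool) : ℂ := if a || b || c then 1 else -1

lemma Preserving.norm_sub_le_of_mul_self {A : Module.End ℂ E} (hA : Preserving A)
    (hAA : A * A = 1) {v w : E} {δ : ℝ} (h : ‖A v - w‖ ≤ δ) : ‖A w - v‖ ≤ δ := by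
  have e : A (A w - v) = w - A v := by
    rw [map_sub, ← Module.End.mul_apply, hAA, Module.End.one_apply]
  rwa [← hA, e, norm_sub_rev]

/-- The roles of `A`, `B`, `C` are free, so that each player can take the first place. Only the
first player's two-round observables are used. -/
lemma approxPauli_of_relations {N : ℕ} {A B C : Fin N → Bool → Module.End ℂ E}
    {A₂ : Fin N → Bool → Fin N → Bool → Module.End ℂ E} {L : E} {δ : ℝ} (hδ : 0 ≤ δ)
    (pA : ∀ i b, Preserving (A i b)) (pB : ∀ i b, Preserving (B i b))
    (pC : ∀ i b, Preserving (C i b)) (pA₂ : ∀ i b j c, Preserving (A₂ i b j c))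
    (sA : ∀ i b, A i b * A i b = 1) (sB : ∀ i b, B i b * B i b = 1)
    (sC : ∀ i b, C i b * C i b = 1) (sA₂ : ∀ i b j c, A₂ i b j c * A₂ i b j c = 1)
    (cAB : ∀ i b j c, Commute (A i b) (B j c)) (cAC : ∀ i b j c, Commute (A i b) (C j c))
    (cBC : ∀ i b j c, Commute (B i b) (C j c))
    (cA₂B : ∀ i b j c k d, Commute (A₂ i b j c) (B k d))
    (cA₂C : ∀ i b j c k d, Commute (A₂ i b j c) (C k d))
    (cA₂ : ∀ i b j c, Commute (A₂ i b j c) (A₂ j c i b))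
    (rel : ∀ i a b c, (a ^^ b ^^ c) = false →
      ‖A i a (B i b (C i c L)) - inputSign a b c • L‖ ≤ δ)
    (rel₂ : ∀ i j, i ≠ j → ∀ a b c d, (a ^^ b ^^ c) = false →
      ‖A₂ i a j d (B i b (C i c L)) - inputSign a b c • L‖ ≤ δ) :
    ApproxPauli A (fun i b => B i (!b) * C i true) L (8 * δ) := by
  have sBv : ∀ i b v, B i b (B i b v) = v := fun i b v => congr($(sB i b) v)
  have sCv : ∀ i b v, C i b (C i b v) = v := fun i b v => congr($(sC i b) v)
  -- The inputs `b`, `!b`, `true` have even parity and are not all `0`, so the sign is `+1`.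
  have close : ∀ i b, ‖A i b L - B i (!b) (C i true L)‖ ≤ δ := fun i b =>
    (pA i b).norm_sub_le_of_mul_self (sA i b)
      (by simpa [inputSign] using rel i b (!b) true (by simp))
  have close₂ : ∀ i b j c, i ≠ j → ‖A₂ i b j c L - B i (!b) (C i true L)‖ ≤ δ :=
    fun i b j c hij => (pA₂ i b j c).norm_sub_le_of_mul_self (sA₂ i b j c)
      (by simpa [inputSign] using rel₂ i j hij b (!b) true c (by simp))
  have closeZ : ∀ i, ‖A i true L - B i true (C i false L)‖ ≤ δ := fun i =>
    (pA i true).norm_sub_le_of_mul_self (sA i true)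
      (by simpa [inputSign] using rel i true true false (by simp))
  have closeX : ∀ i, ‖A i false L - -B i false (C i false L)‖ ≤ δ := fun i =>
    (pA i false).norm_sub_le_of_mul_self (sA i false)
      (by
        have := rel i false false false (by simp)
        rwa [← norm_neg, neg_sub', ← map_neg, inputSign, if_neg (by simp), neg_smul, one_smul,
          neg_neg] at this)
  -- On `L`, both `A i b` and `A₂ i b j c` are close to the same operator of the other players.
  -- Exchanging both factors takes four replacements.
  have half : ∀ i j, i ≠ j → ∀ b c,
      ‖A i b (A j c L) - A₂ i b j c (A₂ j c i b L)‖ ≤ 4 * δ := fun i j hij b c => by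
    have e : A i b (A j c L) - A₂ i b j c (A₂ j c i b L) =
        A i b (A j c L - B j (!c) (C j true L)) +
        (B j (!c) (C j true (A i b L - B i (!b) (C i true L))) +
        B j (!c) (C j true (B i (!b) (C i true L) - A₂ i b j c L))) +
        A₂ i b j c (B j (!c) (C j true L) - A₂ j c i b L) := by
      simp only [map_sub, (cAB _ _ _ _).end_apply, (cAC _ _ _ _).end_apply,
        (cA₂B _ _ _ _ _ _).end_apply, (cA₂C _ _ _ _ _ _).end_apply]
      abel
    rw [e]
    refine (norm_add₃_le).trans ?_
    have h3 := norm_add_le (B j (!c) (C j true (A i b L - B i (!b) (C i true L))))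
        (B j (!c) (C j true (B i (!b) (C i true L) - A₂ i b j c L)))
    rw [pB, pC, pB, pC, norm_sub_rev _ (A₂ i b j c L)] at h3
    rw [pA, pA₂, norm_sub_rev _ (A₂ j c i b L)]
    linarith [close j c, close i b, close₂ i b j c hij, close₂ j c i b hij.symm]
  refine ⟨by positivity, pA, fun i b => (pB _ _).mul (pC _ _), sA,
    fun i b j c => (cAB _ _ _ _).mul_right (cAC _ _ _ _),
    fun i b => (close i b).trans (by linarith), fun i => ?_, fun i j hij b c => ?_⟩
  -- Both products reduce to `B i true (B i false L)`, with opposite signs: the first goes through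
  -- the all-zero query, whose sign is `-1`, the second only through queries of sign `+1`.
  · have e : A i false (A i true L) + A i true (A i false L) =
        A i false (A i true L - B i true (C i false L)) +
        B i true (C i false (A i false L - -B i false (C i false L))) +
        (A i true (A i false L - B i true (C i true L)) +
        B i true (C i true (A i true L - B i false (C i true L)))) := by
      simp only [map_sub, map_neg, (cAB _ _ _ _).end_apply, (cAC _ _ _ _).end_apply,
        ← (cBC _ _ _ _).end_apply, sCv]
      abel
    rw [e]
    refine (norm_add_le _ _).trans ((add_le_add (norm_add_le _ _) (norm_add_le _ _)).trans ?_)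
    rw [pA, pA, pB, pC, pB, pC]
    have h1 := close i false
    have h2 := close i true
    simp only [Bool.not_false, Bool.not_true] at h1 h2
    linarith [closeZ i, closeX i]
  -- The two orders of the product are compared with the same product of commuting two-round
  -- observables.
  · have h1 := half i j hij b c
    have h2 := half j i hij.symm c b
    rw [← (cA₂ i b j c).end_apply] at h2
    have e : A i b (A j c L) - A j c (A i b L) =
        (A i b (A j c L) - A₂ i b j c (A₂ j c i b L)) -
        (A j c (A i b L) - A₂ i b j c (A₂ j c i b L)) := by abel
    rw [e]
    refine (norm_sub_le _ _).trans ?_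
    linarith

/-- A hybrid argument: one player is replaced at a time, the operators of the other two being moved
out of the way as isometric tuples. -/
lemma l2norm_triple_sub_le {ι κ μ : Type*} [Fintype ι] [Fintype κ] [Fintype μ]
    {Sa Ta : ι → Module.End ℂ E} {Sb Tb : κ → Module.End ℂ E} {Sc Tc : μ → Module.End ℂ E}
    {L : E} {ea eb ec : ℝ} (hSb : IsometricTuple Sb) (hSc : IsometricTuple Sc)
    (hTa : IsometricTuple Ta) (hTb : IsometricTuple Tb)
    (cab : ∀ i j, Commute (Sa i) (Sb j)) (cab' : ∀ i j, Commute (Ta i) (Sb j))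
    (cac : ∀ i j, Commute (Sa i) (Sc j)) (cac' : ∀ i j, Commute (Ta i) (Sc j))
    (cbc : ∀ i j, Commute (Sb i) (Sc j)) (cbc' : ∀ i j, Commute (Tb i) (Sc j))
    (ha : l2norm (fun i => Sa i L - Ta i L) ≤ ea) (hb : l2norm (fun i => Sb i L - Tb i L) ≤ eb)
    (hc : l2norm (fun i => Sc i L - Tc i L) ≤ ec) :
    l2norm (fun p : ι × κ × μ => Sa p.1 (Sb p.2.1 (Sc p.2.2 L)) -
      Ta p.1 (Tb p.2.1 (Tc p.2.2 L))) ≤ ea + eb + ec := by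
  have t1 := (hSb.mul hSc).l2norm_comp' fun i => Sa i L - Ta i L
  have t2 := hTa.l2norm_comp fun p : κ × μ => Sc p.2 (Sb p.1 L - Tb p.1 L)
  rw [hSc.l2norm_comp' fun j => Sb j L - Tb j L] at t2
  have t3 := hTa.l2norm_comp fun p : κ × μ => Tb p.1 (Sc p.2 L - Tc p.2 L)
  rw [hTb.l2norm_comp fun j => Sc j L - Tc j L] at t3
  simp only [map_sub, Module.End.mul_apply, ← (cac _ _).end_apply, ← (cac' _ _).end_apply,
    ← (cab _ _).end_apply, ← (cab' _ _).end_apply, ← (cbc _ _).end_apply,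
    ← (cbc' _ _).end_apply] at t1 t2 t3
  refine (l2norm_sub_le _ (fun p => Ta p.1 (Sb p.2.1 (Sc p.2.2 L))) _).trans ?_
  refine (add_le_add t1.le (l2norm_sub_le _ (fun p => Ta p.1 (Tb p.2.1 (Sc p.2.2 L))) _)).trans ?_
  rw [t2, t3]
  linarith

lemma flipBit_flipBit {N : ℕ} (i : Fin N) (q : Fin N → Fin 2 × Fin 2) :
    flipBit i (flipBit i q) = q := by
  have h : ∀ t : Fin 2, t + 1 + 1 = t := by decide
  simp [flipBit, h]

lemma IsometricTuple.flip {N : ℕ} {T : (Fin N → Fin 2 × Fin 2) → Module.End ℂ E}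
    (hT : IsometricTuple T) (i : Fin N) : IsometricTuple fun q => T (flipBit i q) :=
  hT.equiv (Function.Involutive.toPerm _ (flipBit_flipBit i))

lemma IsometricTuple.sign {N : ℕ} {T : (Fin N → Fin 2 × Fin 2) → Module.End ℂ E}
    (hT : IsometricTuple T) (i : Fin N) :
    IsometricTuple fun q => (-1 : ℂ) ^ ((q i).2 : ℕ) • T q :=
  fun v => by simpa [norm_smul] using hT v

/-- The blocks of the product of the swapping isometries of three players, applied to `L`. -/
def tripleBlock {N : ℕ} (A B C : Fin N → Bool → Module.End ℂ E) (L : E)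
    (p : (Fin N → Fin 2 × Fin 2) × (Fin N → Fin 2 × Fin 2) × (Fin N → Fin 2 × Fin 2)) : E :=
  chainBlock N A p.1 (chainBlock N B p.2.1 (chainBlock N C p.2.2 L))

/-! ### Transfer of the game relations through the three chains -/

section Stabilizers

variable {N : ℕ} {A B C A' B' C' : Fin N → Bool → Module.End ℂ E} {L : E} {δ : ℝ}

lemma Commute.chainBlock_chainBlock {R S : Fin N → Bool → Module.End ℂ E}
    (h : ∀ i b j c, Commute (R i b) (S j c)) (q q' : Fin N → Fin 2 × Fin 2) :
    Commute (chainBlock N R q) (chainBlock N S q') :=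
  Commute.chainBlock_right (fun j c => (Commute.chainBlock_right (fun i b => (h i b j c).symm)
    _).symm) _

/-- `Sa`, `Sb`, `Sc` stand for flipped or signed chains. Replacing them by chains preceded by
reflections leaves the product of three reflections on `L`, which `hrel` removes inside an isometry.
-/
lemma l2norm_triple_sub_le_of_rel (pA : ∀ i b, Preserving (A i b))
    (pB : ∀ i b, Preserving (B i b)) (pC : ∀ i b, Preserving (C i b))
    (cAB : ∀ i b j c, Commute (A i b) (B j c)) (cAC : ∀ i b j c, Commute (A i b) (C j c))
    (cBC : ∀ i b j c, Commute (B i b) (C j c)) (i : Fin N) {a b c : Bool} {e : ℝ}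
    {Sa Sb Sc : (Fin N → Fin 2 × Fin 2) → Module.End ℂ E}
    (hSb : IsometricTuple Sb) (hSc : IsometricTuple Sc)
    (cab : ∀ i j, Commute (Sa i) (Sb j)) (cac : ∀ i j, Commute (Sa i) (Sc j))
    (cbc : ∀ i j, Commute (Sb i) (Sc j))
    (cab' : ∀ i b q, Commute (A i b) (Sb q)) (cac' : ∀ i b q, Commute (A i b) (Sc q))
    (cbc' : ∀ i b q, Commute (B i b) (Sc q))
    (ha : l2norm (fun q => Sa q L - chainBlock N A q (A i a L)) ≤ e)
    (hb : l2norm (fun q => Sb q L - chainBlock N B q (B i b L)) ≤ e)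
    (hc : l2norm (fun q => Sc q L - chainBlock N C q (C i c L)) ≤ e)
    (hrel : ‖A i a (B i b (C i c L)) - L‖ ≤ δ) :
    l2norm (fun p : _ × _ × _ => Sa p.1 (Sb p.2.1 (Sc p.2.2 L)) - tripleBlock A B C L p) ≤
      3 * e + δ := by
  have iA := isometricTuple_chainBlock pA
  have iB := isometricTuple_chainBlock pB
  have iC := isometricTuple_chainBlock pC
  have t1 := l2norm_triple_sub_le (Ta := fun q => chainBlock N A q * A i a)
    (Tb := fun q => chainBlock N B q * B i b) (Tc := fun q => chainBlock N C q * C i c)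
    hSb hSc (iA.mul_preserving (pA i a)) (iB.mul_preserving (pB i b)) cab
    (fun q q' => (Commute.chainBlock_right (fun j d => (cab' j d q').symm) q).symm.mul_left
      (cab' _ _ _)) cac
    (fun q q' => (Commute.chainBlock_right (fun j d => (cac' j d q').symm) q).symm.mul_left
      (cac' _ _ _)) cbc
    (fun q q' => (Commute.chainBlock_right (fun j d => (cbc' j d q').symm) q).symm.mul_left
      (cbc' _ _ _)) ha hb hc
  have t2 := (iA.mul (iB.mul iC)).l2norm_apply (A i a (B i b (C i c L)) - L)
  have c1 : ∀ q, Commute (A i a) (chainBlock N B q) :=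
    Commute.chainBlock_right fun j d => cAB _ _ _ _
  have c2 : ∀ q, Commute (A i a) (chainBlock N C q) :=
    Commute.chainBlock_right fun j d => cAC _ _ _ _
  have c3 : ∀ q, Commute (B i b) (chainBlock N C q) :=
    Commute.chainBlock_right fun j d => cBC _ _ _ _
  simp only [Module.End.mul_apply, map_sub, (c1 _).end_apply, (c2 _).end_apply, (c3 _).end_apply,
    (cAB _ _ _ _).end_apply] at t1 t2
  rw [(cAB _ _ _ _).end_apply] at hrel
  exact (l2norm_sub_le _ _ _).trans ((add_le_add t1 (t2.trans_le hrel)).trans_eq (by ring))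

end Stabilizers

end ThreePlayers

/-! ### Rigidity of the blocks -/

section Rigidity

variable {E : Type*} [NormedAddCommGroup E] [InnerProductSpace ℂ E]

/-- The sign of the coefficient of `|r s t⟩` in the state `|G⟩`. -/
def labelSign (r s t : Fin 2) : ℂ := if (r : ℕ) + s + t ≤ 1 then 1 else -1

/-- The sign of the coefficient in the state `|G⟩^{⊗ N}`. -/
def tripleSign {N : ℕ}
    (p : (Fin N → Fin 2 × Fin 2) × (Fin N → Fin 2 × Fin 2) × (Fin N → Fin 2 × Fin 2)) : ℂ :=
  ∏ k, labelSign (p.1 k).2 (p.2.1 k).2 (p.2.2 k).2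

lemma labelSign_mul_self (r s t : Fin 2) : labelSign r s t * labelSign r s t = 1 := by
  unfold labelSign; split_ifs <;> simp

lemma norm_labelSign (r s t : Fin 2) : ‖labelSign r s t‖ = 1 := by
  unfold labelSign; split_ifs <;> simp

/-- This is the stabilizer relation `X ⊗ Z ⊗ Z |G⟩ = |G⟩` in coordinates; the next two lemmas are
its permutations. -/
lemma labelSign_flip₁ (r s t : Fin 2) :
    labelSign (r + 1) s t = (-1) ^ (s : ℕ) * (-1) ^ (t : ℕ) * labelSign r s t := by
  fin_cases r <;> fin_cases s <;> fin_cases t <;> simp [labelSign]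

lemma labelSign_flip₂ (r s t : Fin 2) :
    labelSign r (s + 1) t = (-1) ^ (r : ℕ) * (-1) ^ (t : ℕ) * labelSign r s t := by
  fin_cases r <;> fin_cases s <;> fin_cases t <;> simp [labelSign]

lemma labelSign_flip₃ (r s t : Fin 2) :
    labelSign r s (t + 1) = (-1) ^ (r : ℕ) * (-1) ^ (s : ℕ) * labelSign r s t := by
  fin_cases r <;> fin_cases s <;> fin_cases t <;> simp [labelSign]

variable {N : ℕ}

lemma norm_tripleSign
    (p : (Fin N → Fin 2 × Fin 2) × (Fin N → Fin 2 × Fin 2) × (Fin N → Fin 2 × Fin 2)) :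
    ‖tripleSign p‖ = 1 := by
  simp [tripleSign, norm_prod, norm_labelSign]

lemma tripleSign_mul_self
    (p : (Fin N → Fin 2 × Fin 2) × (Fin N → Fin 2 × Fin 2) × (Fin N → Fin 2 × Fin 2)) :
    tripleSign p * tripleSign p = 1 := by
  simp [tripleSign, ← Finset.prod_mul_distrib, labelSign_mul_self]

lemma prod_eq_mul_prod_of_update {f g : Fin N → ℂ} {c : ℂ} (i : Fin N) (hi : f i = c * g i)
    (h : ∀ k, k ≠ i → f k = g k) : ∏ k, f k = c * ∏ k, g k := by
  rw [← Finset.mul_prod_erase _ f (Finset.mem_univ i), ← Finset.mul_prod_erase _ g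
    (Finset.mem_univ i), hi, mul_assoc]
  congr 2
  exact Finset.prod_congr rfl fun k hk => h k (Finset.ne_of_mem_erase hk)

lemma tripleSign_flip₁ (i : Fin N) (u v w : Fin N → Fin 2 × Fin 2) :
    tripleSign (flipBit i u, v, w) =
      (-1) ^ ((v i).2 : ℕ) * (-1) ^ ((w i).2 : ℕ) * tripleSign (u, v, w) :=
  prod_eq_mul_prod_of_update i (by simp [flipBit, labelSign_flip₁])
    fun k hk => by simp [flipBit, hk]

lemma tripleSign_flip₂ (i : Fin N) (u v w : Fin N → Fin 2 × Fin 2) :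
    tripleSign (u, flipBit i v, w) =
      (-1) ^ ((u i).2 : ℕ) * (-1) ^ ((w i).2 : ℕ) * tripleSign (u, v, w) :=
  prod_eq_mul_prod_of_update i (by simp [flipBit, labelSign_flip₂])
    fun k hk => by simp [flipBit, hk]

lemma tripleSign_flip₃ (i : Fin N) (u v w : Fin N → Fin 2 × Fin 2) :
    tripleSign (u, v, flipBit i w) =
      (-1) ^ ((u i).2 : ℕ) * (-1) ^ ((v i).2 : ℕ) * tripleSign (u, v, w) :=
  prod_eq_mul_prod_of_update i (by simp [flipBit, labelSign_flip₃])
    fun k hk => by simp [flipBit, hk]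

/-- Three players whose chains of swapping maps approximately turn `R i false` and `R i true` into
the Pauli operators on the `i`-th qubit, and a state that approximately satisfies the relations
of the GHZ game. -/
structure ApproxGHZ (A B C : Fin N → Bool → Module.End ℂ E) (L : E) (e : ℝ) : Prop where
  preserving₁ : ∀ i b, Preserving (A i b)
  preserving₂ : ∀ i b, Preserving (B i b)
  preserving₃ : ∀ i b, Preserving (C i b)
  commute₁₂ : ∀ i b j c, Commute (A i b) (B j c)
  commute₁₃ : ∀ i b j c, Commute (A i b) (C j c)
  commute₂₃ : ∀ i b j c, Commute (B i b) (C j c)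
  flip₁ : ∀ i, l2norm (fun q => chainBlock N A (flipBit i q) L -
    chainBlock N A q (A i false L)) ≤ e
  flip₂ : ∀ i, l2norm (fun q => chainBlock N B (flipBit i q) L -
    chainBlock N B q (B i false L)) ≤ e
  flip₃ : ∀ i, l2norm (fun q => chainBlock N C (flipBit i q) L -
    chainBlock N C q (C i false L)) ≤ e
  sign₁ : ∀ i, l2norm (fun q => (-1 : ℂ) ^ ((q i).2 : ℕ) • chainBlock N A q L -
    chainBlock N A q (A i true L)) ≤ e
  sign₂ : ∀ i, l2norm (fun q => (-1 : ℂ) ^ ((q i).2 : ℕ) • chainBlock N B q L -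
    chainBlock N B q (B i true L)) ≤ e
  sign₃ : ∀ i, l2norm (fun q => (-1 : ℂ) ^ ((q i).2 : ℕ) • chainBlock N C q L -
    chainBlock N C q (C i true L)) ≤ e
  rel₁ : ∀ i, ‖A i false (B i true (C i true L)) - L‖ ≤ e
  rel₂ : ∀ i, ‖A i true (B i false (C i true L)) - L‖ ≤ e
  rel₃ : ∀ i, ‖A i true (B i true (C i false L)) - L‖ ≤ e

/-- The blocks of the product of the swapping isometries applied to `L`, multiplied by the signs
of the coefficients of `|G⟩^{⊗ N}`. -/
def twistedBlock (A B C : Fin N → Bool → Module.End ℂ E) (L : E)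
    (p : (Fin N → Fin 2 × Fin 2) × (Fin N → Fin 2 × Fin 2) × (Fin N → Fin 2 × Fin 2)) : E :=
  tripleSign p • tripleBlock A B C L p

lemma twistedBlock_sub_twistedBlock (A B C : Fin N → Bool → Module.End ℂ E) (L : E)
    {p p' : (Fin N → Fin 2 × Fin 2) × (Fin N → Fin 2 × Fin 2) × (Fin N → Fin 2 × Fin 2)} {c : ℂ}
    (h : tripleSign p' = c * tripleSign p) :
    ‖twistedBlock A B C L p' - twistedBlock A B C L p‖ =
      ‖c • tripleBlock A B C L p' - tripleBlock A B C L p‖ := by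
  rw [twistedBlock, twistedBlock, h, mul_comm, mul_smul, ← smul_sub, norm_smul, norm_tripleSign,
    one_mul]

lemma l2norm_congr {ι : Type*} [Fintype ι] {a b : ι → E} (h : ∀ i, ‖a i‖ = ‖b i‖) :
    l2norm a = l2norm b :=
  l2norm_eq_of_sq (l2norm_nonneg _) (by simp [l2norm_sq, h])

namespace ApproxGHZ

variable {A B C : Fin N → Bool → Module.End ℂ E} {L : E} {e : ℝ}

/-- Flipping Alice's label is compensated by the sign labels of Bob and Charlie, as in the relation
`XZZ`; the same two signs arise from `tripleSign`. -/
lemma l2norm_flip₁_le (h : ApproxGHZ A B C L e) (i : Fin N) :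
    l2norm (fun p : _ × _ × _ => twistedBlock A B C L (flipBit i p.1, p.2.1, p.2.2) -
      twistedBlock A B C L p) ≤ 4 * e := by
  have cAB := Commute.chainBlock_chainBlock h.commute₁₂
  have cAC := Commute.chainBlock_chainBlock h.commute₁₃
  have cBC := Commute.chainBlock_chainBlock h.commute₂₃
  have iB := isometricTuple_chainBlock h.preserving₂
  have iC := isometricTuple_chainBlock h.preserving₃
  have := l2norm_triple_sub_le_of_rel h.preserving₁ h.preserving₂ h.preserving₃ h.commute₁₂
    h.commute₁₃ h.commute₂₃ i (Sa := fun q => chainBlock N A (flipBit i q)) (iB.sign i) (iC.sign i)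
    (fun _ _ => (cAB _ _).smul_right _) (fun _ _ => (cAC _ _).smul_right _)
    (fun _ _ => ((cBC _ _).smul_right _).smul_left _)
    (fun _ _ _ => (Commute.chainBlock_right (h.commute₁₂ _ _) _).smul_right _)
    (fun _ _ _ => (Commute.chainBlock_right (h.commute₁₃ _ _) _).smul_right _)
    (fun _ _ _ => (Commute.chainBlock_right (h.commute₂₃ _ _) _).smul_right _)
    (h.flip₁ i) (h.sign₂ i) (h.sign₃ i) (h.rel₁ i)
  refine (l2norm_congr fun p => ?_).trans_le (this.trans_eq (by ring))
  rw [twistedBlock_sub_twistedBlock A B C L (tripleSign_flip₁ i p.1 p.2.1 p.2.2)]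
  simp only [tripleBlock, mul_smul, LinearMap.smul_apply, map_smul]
  rw [smul_comm]

lemma l2norm_flip₂_le (h : ApproxGHZ A B C L e) (i : Fin N) :
    l2norm (fun p : _ × _ × _ => twistedBlock A B C L (p.1, flipBit i p.2.1, p.2.2) -
      twistedBlock A B C L p) ≤ 4 * e := by
  have cAB := Commute.chainBlock_chainBlock h.commute₁₂
  have cAC := Commute.chainBlock_chainBlock h.commute₁₃
  have cBC := Commute.chainBlock_chainBlock h.commute₂₃
  have iB := isometricTuple_chainBlock h.preserving₂
  have iC := isometricTuple_chainBlock h.preserving₃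
  have := l2norm_triple_sub_le_of_rel h.preserving₁ h.preserving₂ h.preserving₃ h.commute₁₂
    h.commute₁₃ h.commute₂₃ i (Sa := fun q => (-1 : ℂ) ^ ((q i).2 : ℕ) • chainBlock N A q)
    (iB.flip i) (iC.sign i)
    (fun _ _ => (cAB _ _).smul_left _) (fun _ _ => ((cAC _ _).smul_right _).smul_left _)
    (fun _ _ => (cBC _ _).smul_right _)
    (fun _ _ _ => Commute.chainBlock_right (h.commute₁₂ _ _) _)
    (fun _ _ _ => (Commute.chainBlock_right (h.commute₁₃ _ _) _).smul_right _)
    (fun _ _ _ => (Commute.chainBlock_right (h.commute₂₃ _ _) _).smul_right _)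
    (h.sign₁ i) (h.flip₂ i) (h.sign₃ i) (h.rel₂ i)
  refine (l2norm_congr fun p => ?_).trans_le (this.trans_eq (by ring))
  rw [twistedBlock_sub_twistedBlock A B C L (tripleSign_flip₂ i p.1 p.2.1 p.2.2)]
  simp only [tripleBlock, mul_smul, LinearMap.smul_apply, map_smul]
  rw [smul_comm]

lemma l2norm_flip₃_le (h : ApproxGHZ A B C L e) (i : Fin N) :
    l2norm (fun p : _ × _ × _ => twistedBlock A B C L (p.1, p.2.1, flipBit i p.2.2) -
      twistedBlock A B C L p) ≤ 4 * e := by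
  have cAB := Commute.chainBlock_chainBlock h.commute₁₂
  have cAC := Commute.chainBlock_chainBlock h.commute₁₃
  have cBC := Commute.chainBlock_chainBlock h.commute₂₃
  have iB := isometricTuple_chainBlock h.preserving₂
  have iC := isometricTuple_chainBlock h.preserving₃
  have := l2norm_triple_sub_le_of_rel h.preserving₁ h.preserving₂ h.preserving₃ h.commute₁₂
    h.commute₁₃ h.commute₂₃ i (Sa := fun q => (-1 : ℂ) ^ ((q i).2 : ℕ) • chainBlock N A q)
    (iB.sign i) (iC.flip i)
    (fun _ _ => ((cAB _ _).smul_right _).smul_left _) (fun _ _ => (cAC _ _).smul_left _)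
    (fun _ _ => (cBC _ _).smul_left _)
    (fun _ _ _ => (Commute.chainBlock_right (h.commute₁₂ _ _) _).smul_right _)
    (fun _ _ _ => Commute.chainBlock_right (h.commute₁₃ _ _) _)
    (fun _ _ _ => Commute.chainBlock_right (h.commute₂₃ _ _) _)
    (h.sign₁ i) (h.sign₂ i) (h.flip₃ i) (h.rel₃ i)
  refine (l2norm_congr fun p => ?_).trans_le (this.trans_eq (by ring))
  rw [twistedBlock_sub_twistedBlock A B C L (tripleSign_flip₃ i p.1 p.2.1 p.2.2)]
  simp only [tripleBlock, mul_smul, LinearMap.smul_apply, map_smul]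
  rw [smul_comm]

end ApproxGHZ

end Rigidity

/-! ### Approximate shift invariance and averaging over label shifts -/

section Shifts

variable {N : ℕ}

/-- Adding `x` to the labels of the qubits `Q`. -/
def shift (x : Fin N → Fin 2) (u : Fin N → Fin 2 × Fin 2) : Fin N → Fin 2 × Fin 2 :=
  fun k => ((u k).1, (u k).2 + x k)

lemma shift_zero (u : Fin N → Fin 2 × Fin 2) : shift 0 u = u := by
  funext k; simp [shift]

lemma shift_add (x y : Fin N → Fin 2) (u : Fin N → Fin 2 × Fin 2) :
    shift (x + y) u = shift x (shift y u) := by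
  funext k; simp [shift, add_comm (x k), add_assoc]

lemma shift_single (i : Fin N) (u : Fin N → Fin 2 × Fin 2) :
    shift (Pi.single i 1) u = flipBit i u := by
  funext k
  by_cases hk : k = i
  · subst hk; simp [shift, flipBit]
  · simp [shift, flipBit, hk]

/-- Adding `g` to the labels of the qubits `Q` of all three players. -/
def tripleShift (g : (Fin N → Fin 2) × (Fin N → Fin 2) × (Fin N → Fin 2))
    (p : (Fin N → Fin 2 × Fin 2) × (Fin N → Fin 2 × Fin 2) × (Fin N → Fin 2 × Fin 2)) :
    (Fin N → Fin 2 × Fin 2) × (Fin N → Fin 2 × Fin 2) × (Fin N → Fin 2 × Fin 2) :=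
  (shift g.1 p.1, shift g.2.1 p.2.1, shift g.2.2 p.2.2)

lemma tripleShift_add (g h : (Fin N → Fin 2) × (Fin N → Fin 2) × (Fin N → Fin 2))
    (p : (Fin N → Fin 2 × Fin 2) × (Fin N → Fin 2 × Fin 2) × (Fin N → Fin 2 × Fin 2)) :
    tripleShift (g + h) p = tripleShift g (tripleShift h p) := by
  simp [tripleShift, shift_add]

lemma tripleShift_zero
    (p : (Fin N → Fin 2 × Fin 2) × (Fin N → Fin 2 × Fin 2) × (Fin N → Fin 2 × Fin 2)) :
    tripleShift 0 p = p := by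
  simp [tripleShift, shift_zero]

/-- `tripleShift g` as a permutation. -/
def tripleShiftEquiv (g : (Fin N → Fin 2) × (Fin N → Fin 2) × (Fin N → Fin 2)) :
    Equiv.Perm ((Fin N → Fin 2 × Fin 2) × (Fin N → Fin 2 × Fin 2) × (Fin N → Fin 2 × Fin 2)) where
  toFun := tripleShift g
  invFun := tripleShift (-g)
  left_inv p := by rw [← tripleShift_add, neg_add_cancel, tripleShift_zero]
  right_inv p := by rw [← tripleShift_add, add_neg_cancel, tripleShift_zero]

variable {E : Type*} [NormedAddCommGroup E] [InnerProductSpace ℂ E]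

/-- The change of a tuple under a shift of the labels. -/
def shiftDefect
    (a : (Fin N → Fin 2 × Fin 2) × (Fin N → Fin 2 × Fin 2) × (Fin N → Fin 2 × Fin 2) → E)
    (g : (Fin N → Fin 2) × (Fin N → Fin 2) × (Fin N → Fin 2)) : ℝ :=
  l2norm fun p => a (tripleShift g p) - a p

/-- The mean of a tuple over all shifts of the labels. -/
def shiftMean
    (a : (Fin N → Fin 2 × Fin 2) × (Fin N → Fin 2 × Fin 2) × (Fin N → Fin 2 × Fin 2) → E)
    (p : (Fin N → Fin 2 × Fin 2) × (Fin N → Fin 2 × Fin 2) × (Fin N → Fin 2 × Fin 2)) : E :=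
  ((Fintype.card ((Fin N → Fin 2) × (Fin N → Fin 2) × (Fin N → Fin 2)) : ℂ)⁻¹) •
    ∑ g, a (tripleShift g p)

variable
  {a : (Fin N → Fin 2 × Fin 2) × (Fin N → Fin 2 × Fin 2) × (Fin N → Fin 2 × Fin 2) → E}

lemma shiftDefect_zero : shiftDefect a 0 = 0 := by
  simpa [shiftDefect, tripleShift_zero] using
    l2norm_eq_of_sq (a := fun _ => (0 : E)) le_rfl (by simp)

/-- A shift permutes the labels, so the defect of `g` is the same before and after applying `h`. -/
lemma shiftDefect_add_le (g h : (Fin N → Fin 2) × (Fin N → Fin 2) × (Fin N → Fin 2)) :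
    shiftDefect a (g + h) ≤ shiftDefect a g + shiftDefect a h := by
  have h1 := l2norm_sub_le (fun p => a (tripleShift g (tripleShift h p)))
    (fun p => a (tripleShift h p)) a
  have h2 := l2norm_equiv (tripleShiftEquiv h) fun p => a (tripleShift g p) - a p
  simp only [tripleShiftEquiv, Equiv.coe_fn_mk] at h2
  rw [h2] at h1
  simpa only [shiftDefect, tripleShift_add] using h1

lemma shiftDefect_le_of_additive {φ : (Fin N → Fin 2) →+
      (Fin N → Fin 2) × (Fin N → Fin 2) × (Fin N → Fin 2)} {e : ℝ} (he : 0 ≤ e)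
    (h : ∀ i, shiftDefect a (φ (Pi.single i 1)) ≤ e) (x : Fin N → Fin 2) :
    shiftDefect a (φ x) ≤ N * e := by
  have h1 := Finset.le_sum_of_subadditive (fun x => shiftDefect a (φ x))
    (by simp [shiftDefect_zero]) (fun x y => by rw [map_add]; exact shiftDefect_add_le _ _)
    Finset.univ fun i => Pi.single i (x i)
  rw [Finset.univ_sum_single] at h1
  refine h1.trans ((Finset.sum_le_sum fun i _ => (?_ : _ ≤ e)).trans_eq (by simp))
  have h2 : ∀ t : Fin 2, t = 0 ∨ t = 1 := by decide
  rcases h2 (x i) with h3 | h3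
  · simpa [h3, shiftDefect_zero] using he
  · rw [h3]; exact h i

lemma l2norm_sub_shiftMean_le {e : ℝ} (h : ∀ g, shiftDefect a g ≤ e) :
    l2norm (fun p => a p - shiftMean a p) ≤ e := by
  set n := Fintype.card ((Fin N → Fin 2) × (Fin N → Fin 2) × (Fin N → Fin 2)) with hn
  have hn0 : (n : ℂ) ≠ 0 := by simp [hn]
  have hn1 : (n : ℝ) ≠ 0 := by exact_mod_cast hn0
  have e1 : ∀ p, a p - shiftMean a p = (n : ℂ)⁻¹ • ∑ g, (a p - a (tripleShift g p)) := fun p => by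
    rw [Finset.sum_sub_distrib, smul_sub, Finset.sum_const, Finset.card_univ, ← hn,
      ← Nat.cast_smul_eq_nsmul ℂ, inv_smul_smul₀ hn0]
    rfl
  simp only [e1, l2norm_smul]
  calc _ ≤ ‖(n : ℂ)⁻¹‖ * ∑ g, shiftDefect a g := by
        gcongr
        refine (l2norm_sum_le _ _).trans_eq (Finset.sum_congr rfl fun g _ => ?_)
        rw [l2norm_sub_comm]; rfl
    _ ≤ ‖(n : ℂ)⁻¹‖ * (n * e) := by
        gcongr
        exact (Finset.sum_le_sum fun g _ => h g).trans_eq (by simp [hn])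
    _ = e := by
        rw [norm_inv, Complex.norm_natCast]; field_simp

lemma shiftMean_tripleShift (g : (Fin N → Fin 2) × (Fin N → Fin 2) × (Fin N → Fin 2))
    (p : (Fin N → Fin 2 × Fin 2) × (Fin N → Fin 2 × Fin 2) × (Fin N → Fin 2 × Fin 2)) :
    shiftMean a (tripleShift g p) = shiftMean a p := by
  simp only [shiftMean, ← tripleShift_add]
  congr 1
  exact Fintype.sum_equiv (Equiv.addRight g) _ _ fun _ => rfl

lemma shiftMean_eq (u v w : Fin N → Fin 2 × Fin 2) :
    shiftMean a (u, v, w) = shiftMean a (fun k => ((u k).1, 0), fun k => ((v k).1, 0),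
      fun k => ((w k).1, 0)) := by
  -- Shifting the zero labels by the `Q` labels of `u`, `v`, `w` recovers these.
  rw [← shiftMean_tripleShift (fun k => (u k).2, fun k => (v k).2, fun k => (w k).2)
    (fun k => ((u k).1, 0), _)]
  congr 1
  simp only [tripleShift, Prod.mk.injEq]
  refine ⟨?_, ?_, ?_⟩ <;> funext k <;> simp [shift]

lemma ApproxGHZ.l2norm_sub_shiftMean_le {A B C : Fin N → Bool → Module.End ℂ E} {L : E} {e : ℝ}
    (he : 0 ≤ e) (h : ApproxGHZ A B C L e) :
    l2norm (fun p => twistedBlock A B C L p - shiftMean (twistedBlock A B C L) p) ≤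
      12 * N * e := by
  refine GHZ.l2norm_sub_shiftMean_le fun g => ?_
  have h1 := shiftDefect_le_of_additive (a := twistedBlock A B C L) (e := 4 * e)
    (φ := AddMonoidHom.inl _ _) (by positivity)
    (fun i => by simpa [shiftDefect, tripleShift, shift_single, shift_zero] using
      h.l2norm_flip₁_le i) g.1
  have h2 := shiftDefect_le_of_additive (a := twistedBlock A B C L) (e := 4 * e)
    (φ := (AddMonoidHom.inr _ _).comp (AddMonoidHom.inl _ _)) (by positivity)
    (fun i => by simpa [shiftDefect, tripleShift, shift_single, shift_zero] using
      h.l2norm_flip₂_le i) g.2.1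
  have h3 := shiftDefect_le_of_additive (a := twistedBlock A B C L) (e := 4 * e)
    (φ := (AddMonoidHom.inr _ _).comp (AddMonoidHom.inr _ _)) (by positivity)
    (fun i => by simpa [shiftDefect, tripleShift, shift_single, shift_zero] using
      h.l2norm_flip₃_le i) g.2.2
  have e1 : g = (g.1, 0) + ((0, g.2.1, 0) + (0, 0, g.2.2)) := by simp
  have h4 := shiftDefect_add_le (a := twistedBlock A B C L) (g.1, 0)
    ((0, g.2.1, 0) + (0, 0, g.2.2))
  have h5 := shiftDefect_add_le (a := twistedBlock A B C L) (0, g.2.1, 0) (0, 0, g.2.2)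
  rw [← e1] at h4
  simp only [AddMonoidHom.inl_apply, AddMonoidHom.comp_apply, AddMonoidHom.inr_apply] at h1 h2 h3
  linarith

end Shifts

/-! ### Matrices as operators -/

section Matrices

set_option linter.unusedSectionVars false

variable {α β γ : Type*} [Fintype α] [DecidableEq α] [Fintype β] [DecidableEq β]
  [Fintype γ] [DecidableEq γ]

variable (β) in
/-- `M ↦ M ⊗ 1` as an algebra homomorphism. -/
def kroneckerOneHom : Matrix α α ℂ →ₐ[ℂ] Matrix (α × β) (α × β) ℂ where
  toFun M := M ⊗ₖ 1
  map_one' := Matrix.one_kronecker_one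
  map_mul' M M' := by rw [← Matrix.mul_kronecker_mul, mul_one]
  map_zero' := Matrix.zero_kronecker _
  map_add' M M' := Matrix.add_kronecker _ _ _
  commutes' r := by
    simp only [Algebra.algebraMap_eq_smul_one, Matrix.smul_kronecker, Matrix.one_kronecker_one]

variable (α) in
/-- `M ↦ 1 ⊗ M` as an algebra homomorphism. -/
def oneKroneckerHom : Matrix β β ℂ →ₐ[ℂ] Matrix (α × β) (α × β) ℂ where
  toFun M := 1 ⊗ₖ M
  map_one' := Matrix.one_kronecker_one
  map_mul' M M' := by rw [← Matrix.mul_kronecker_mul, mul_one]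
  map_zero' := Matrix.kronecker_zero _
  map_add' M M' := Matrix.kronecker_add _ _ _
  commutes' r := by
    simp only [Algebra.algebraMap_eq_smul_one, Matrix.kronecker_smul, Matrix.one_kronecker_one]

/-- Square matrices as operators on the Euclidean space. -/
def euclideanHom : Matrix α α ℂ →ₐ[ℂ] Module.End ℂ (EuclideanSpace ℂ α) :=
  (Matrix.toLpLinAlgEquiv 2 : Matrix α α ℂ ≃ₐ[ℂ] _)

lemma euclideanHom_apply (M : Matrix α α ℂ) : euclideanHom M = Matrix.toEuclideanLin M := rfl

variable (α β γ) in
/-- Alice's matrices as operators on `A ⊗ B ⊗ C`. -/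
def aliceHom : Matrix α α ℂ →ₐ[ℂ] Module.End ℂ (EuclideanSpace ℂ (α × β × γ)) :=
  euclideanHom.comp (kroneckerOneHom (β × γ))

variable (α β γ) in
/-- Bob's matrices as operators on `A ⊗ B ⊗ C`. -/
def bobHom : Matrix β β ℂ →ₐ[ℂ] Module.End ℂ (EuclideanSpace ℂ (α × β × γ)) :=
  euclideanHom.comp ((oneKroneckerHom α).comp (kroneckerOneHom γ))

variable (α β γ) in
/-- Charlie's matrices as operators on `A ⊗ B ⊗ C`. -/
def charlieHom : Matrix γ γ ℂ →ₐ[ℂ] Module.End ℂ (EuclideanSpace ℂ (α × β × γ)) :=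
  euclideanHom.comp ((oneKroneckerHom α).comp (oneKroneckerHom β))

lemma commute_kroneckerOneHom_oneKroneckerHom (M : Matrix α α ℂ) (M' : Matrix β β ℂ) :
    Commute (kroneckerOneHom β M) (oneKroneckerHom α M') := by
  change M ⊗ₖ 1 * 1 ⊗ₖ M' = 1 ⊗ₖ M' * M ⊗ₖ 1
  simp [← Matrix.mul_kronecker_mul]

lemma commute_aliceHom_bobHom (M : Matrix α α ℂ) (M' : Matrix β β ℂ) :
    Commute (aliceHom α β γ M) (bobHom α β γ M') :=
  (commute_kroneckerOneHom_oneKroneckerHom M _).map euclideanHom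

lemma commute_aliceHom_charlieHom (M : Matrix α α ℂ) (M' : Matrix γ γ ℂ) :
    Commute (aliceHom α β γ M) (charlieHom α β γ M') :=
  (commute_kroneckerOneHom_oneKroneckerHom M _).map euclideanHom

lemma commute_bobHom_charlieHom (M : Matrix β β ℂ) (M' : Matrix γ γ ℂ) :
    Commute (bobHom α β γ M) (charlieHom α β γ M') :=
  ((commute_kroneckerOneHom_oneKroneckerHom M _).map (oneKroneckerHom α)).map euclideanHom

lemma toEuclideanLin_kronecker (M : Matrix α α ℂ) (M' : Matrix β β ℂ) (M'' : Matrix γ γ ℂ) :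
    Matrix.toEuclideanLin (M ⊗ₖ (M' ⊗ₖ M'')) =
      aliceHom α β γ M * (bobHom α β γ M' * charlieHom α β γ M'') := by
  have : M ⊗ₖ (M' ⊗ₖ M'') = M ⊗ₖ 1 * (1 ⊗ₖ (M' ⊗ₖ 1) * 1 ⊗ₖ (1 ⊗ₖ M'')) := by
    simp [← Matrix.mul_kronecker_mul]
  rw [← euclideanHom_apply, this, map_mul, map_mul]
  rfl

lemma inner_toEuclideanLin (M : Matrix α β ℂ) (v : EuclideanSpace ℂ α) (w : EuclideanSpace ℂ β) :
    inner ℂ v (Matrix.toEuclideanLin M w) = inner ℂ (Matrix.toEuclideanLin Mᴴ v) w := by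
  simp only [EuclideanSpace.inner_eq_star_dotProduct, Matrix.toLpLin_apply]
  rw [Matrix.star_mulVec, Matrix.conjTranspose_conjTranspose, dotProduct_comm,
    dotProduct_comm w.ofLp, Matrix.dotProduct_mulVec]

lemma norm_toEuclideanLin {κ : Type*} [Fintype κ] {M : Matrix κ α ℂ} (hM : Mᴴ * M = 1)
    (v : EuclideanSpace ℂ α) : ‖Matrix.toEuclideanLin M v‖ = ‖v‖ := by
  classical
  have h : inner ℂ (Matrix.toEuclideanLin M v) (Matrix.toEuclideanLin M v) = inner ℂ v v := by
    rw [← Matrix.conjTranspose_conjTranspose M, ← inner_toEuclideanLin,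
      Matrix.conjTranspose_conjTranspose, ← LinearMap.comp_apply, ← Matrix.toLpLin_mul_same, hM,
      Matrix.toLpLin_one, LinearMap.id_apply]
  rw [inner_self_eq_norm_sq_to_K, inner_self_eq_norm_sq_to_K] at h
  exact (sq_eq_sq₀ (norm_nonneg _) (norm_nonneg _)).1 (by exact_mod_cast h)

namespace IsReflection

lemma one : IsReflection (1 : Matrix α α ℂ) := ⟨Matrix.isHermitian_one, by simp⟩

lemma kronecker {R : Matrix α α ℂ} {S : Matrix β β ℂ} (hR : IsReflection R)
    (hS : IsReflection S) : IsReflection (R ⊗ₖ S) := by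
  refine ⟨?_, ?_⟩
  · rw [Matrix.IsHermitian, Matrix.conjTranspose_kronecker, hR.isHermitian.eq, hS.isHermitian.eq]
  · rw [← Matrix.mul_kronecker_mul, hR.mul_self, hS.mul_self, Matrix.one_kronecker_one]

lemma preserving {R : Matrix α α ℂ} (hR : IsReflection R) : Preserving (euclideanHom R) :=
  norm_toEuclideanLin (by rw [hR.isHermitian.eq, hR.mul_self])

lemma preserving_alice {R : Matrix α α ℂ} (hR : IsReflection R) :
    Preserving (aliceHom α β γ R) := (hR.kronecker one).preserving

lemma preserving_bob {R : Matrix β β ℂ} (hR : IsReflection R) :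
    Preserving (bobHom α β γ R) := (one.kronecker (hR.kronecker one)).preserving

lemma preserving_charlie {R : Matrix γ γ ℂ} (hR : IsReflection R) :
    Preserving (charlieHom α β γ R) := (one.kronecker (one.kronecker hR)).preserving

lemma map_mul_self {A : Type*} [Ring A] [Algebra ℂ A] {R : Matrix α α ℂ} (hR : IsReflection R)
    (φ : Matrix α α ℂ →ₐ[ℂ] A) : φ R * φ R = 1 := by
  rw [← map_mul, hR.mul_self, map_one]

end IsReflection

/-! ### The blocks of the swapping isometries -/

lemma const_mul_self : (1 / (Real.sqrt 2 : ℂ)) * (1 / (Real.sqrt 2 : ℂ)) = 1 / 2 := by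
  rw [div_mul_div_comm, ← Complex.ofReal_mul, Real.mul_self_sqrt (by norm_num)]
  norm_num

/-- The blocks of a matrix on `Q ⊗ A`. -/
def qubitBlock (M : Matrix (Fin 2 × α) (Fin 2 × α) ℂ) (t s : Fin 2) : Matrix α α ℂ :=
  Matrix.of fun x y => M (t, x) (s, y)

lemma qubitBlock_mul (M M' : Matrix (Fin 2 × α) (Fin 2 × α) ℂ) (t s : Fin 2) :
    qubitBlock (M * M') t s =
      qubitBlock M t 0 * qubitBlock M' 0 s + qubitBlock M t 1 * qubitBlock M' 1 s := by
  ext x y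
  simp [qubitBlock, Matrix.mul_apply, Fintype.sum_prod_type]

lemma qubitBlock_ctrl (U : Matrix α α ℂ) (t s : Fin 2) :
    qubitBlock (ctrl U) t s = if t = s then U ^ (t : ℕ) else 0 := by
  ext x y
  fin_cases t <;> fin_cases s <;> simp [qubitBlock, ctrl]

lemma qubitBlock_hadamard (t s : Fin 2) :
    qubitBlock (hadamard ⊗ₖ (1 : Matrix α α ℂ)) t s =
      ((1 / (Real.sqrt 2 : ℂ)) * (-1) ^ ((t : ℕ) * s)) • 1 := by
  ext x y
  fin_cases t <;> fin_cases s <;> simp [qubitBlock, hadamard]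

/-- The outer controlled gates contribute `X ^ s` and `X ^ t`; conjugating `C(Z)` by Hadamards
yields `(1 ± Z) / 2`. -/
lemma qubitBlock_swap (X Z : Matrix α α ℂ) (t s : Fin 2) :
    qubitBlock (ctrl X * (hadamard ⊗ₖ 1) * ctrl Z * (hadamard ⊗ₖ 1) * ctrl X) t s =
      (1 / 2 : ℂ) • (X ^ (t : ℕ) * (1 + (-1 : ℂ) ^ ((s : ℕ) + t) • Z) * X ^ (s : ℕ)) := by
  rw [← const_mul_self]
  simp only [qubitBlock_mul, qubitBlock_ctrl, qubitBlock_hadamard]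
  fin_cases t <;> fin_cases s <;>
    simp [smul_smul, mul_add, add_mul, smul_add]

lemma swapMap_apply (X Z : Matrix α α ℂ) (s t : Fin 2) (x y : α) :
    swapMap X Z (s, t, x) y = swapBlock X Z (s, t) x y := by
  have h := congr($(qubitBlock_swap X Z t s) x y)
  simp only [qubitBlock, Matrix.of_apply] at h
  have e : swapMap X Z (s, t, x) y =
      (ctrl X * (hadamard ⊗ₖ 1) * ctrl Z * (hadamard ⊗ₖ 1) * ctrl X :
        Matrix (Fin 2 × α) (Fin 2 × α) ℂ) (t, x) (s, y) *
        (1 / (Real.sqrt 2 : ℂ)) := by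
    -- The Bell state equates the input label on `Q` with the label on `Q̄`, so a single term
    -- survives.
    rw [swapMap, Matrix.mul_apply, Fintype.sum_eq_single (s, s, y)]
    · simp [bellPrep]
    · rintro ⟨s', t', z⟩ hne
      simp only [Matrix.kroneckerMap_apply, bellPrep, Matrix.of_apply, Matrix.one_apply]
      split_ifs with h1 h2 <;> simp_all
  rw [e, h, swapBlock, Matrix.smul_apply, Matrix.smul_apply, smul_eq_mul, smul_eq_mul]
  field_simp

lemma swapChain_apply {k : ℕ} (R : Fin k → Bool → Matrix α α ℂ) (q : Fin k → Fin 2 × Fin 2)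
    (x y : α) : swapChain k (fun i => R i false) (fun i => R i true) (q, x) y =
      chainBlock k R q x y := by
  induction k generalizing x with
  | zero => simp [swapChain, chainBlock, Matrix.one_apply]
  | succ k ih =>
    rw [swapChain, chainBlock, Matrix.submatrix_apply, Matrix.mul_apply, Matrix.mul_apply,
      Fintype.sum_prod_type, Fintype.sum_eq_single (Fin.init q)]
    · simp [swapMap_apply, ih fun i => R i.castSucc]
    · intro q' hq'
      simp [hq'.symm]

lemma conjTranspose_mul_self_of_norm {M : Matrix β α ℂ}
    (h : ∀ v, ‖Matrix.toEuclideanLin M v‖ = ‖v‖) : Mᴴ * M = 1 := by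
  apply Matrix.toEuclideanLin.injective
  refine LinearMap.ext fun w => ext_inner_left ℂ fun v => ?_
  have h1 := LinearIsometry.inner_map_map ⟨Matrix.toEuclideanLin M, h⟩ v w
  rw [Matrix.toLpLin_mul_same, LinearMap.comp_apply, inner_toEuclideanLin,
    Matrix.conjTranspose_conjTranspose, Matrix.toLpLin_one]
  exact h1

lemma toEuclideanLin_isometry_apply {N : ℕ} (P : Player N α) (v : EuclideanSpace ℂ α)
    (u : Fin N → Fin 2 × Fin 2) (x : α) : Matrix.toEuclideanLin P.isometry v (u, x) =
      chainBlock N (fun i b => euclideanHom (P.single i b)) u v x := by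
  rw [← map_chainBlock, euclideanHom_apply]
  simp only [Matrix.toLpLin_apply, Matrix.mulVec, dotProduct, Player.isometry]
  exact Finset.sum_congr rfl fun y _ => by rw [swapChain_apply]

lemma isometry_conjTranspose_mul_self {N : ℕ} (P : Player N α) :
    P.isometryᴴ * P.isometry = 1 := by
  refine conjTranspose_mul_self_of_norm fun v => ?_
  have h := isometricTuple_chainBlock (fun i b => (P.single_isReflection i b).preserving) v
  rw [← sq_eq_sq₀ (norm_nonneg _) (norm_nonneg _), ← h, EuclideanSpace.norm_sq_eq,
    Fintype.sum_prod_type]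
  simp only [EuclideanSpace.norm_sq_eq, toEuclideanLin_isometry_apply]

lemma toEuclideanLin_isometry_kronecker_apply {N : ℕ} (P : Player N α) (P' : Player N β)
    (P'' : Player N γ) (L : EuclideanSpace ℂ (α × β × γ)) (u v w : Fin N → Fin 2 × Fin 2)
    (x : α) (y : β) (z : γ) :
    Matrix.toEuclideanLin (P.isometry ⊗ₖ (P'.isometry ⊗ₖ P''.isometry)) L
        ((u, x), (v, y), (w, z)) =
      tripleBlock (fun i b => aliceHom α β γ (P.single i b))
        (fun i b => bobHom α β γ (P'.single i b)) (fun i b => charlieHom α β γ (P''.single i b)) L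
        (u, v, w) (x, y, z) := by
  rw [tripleBlock, ← map_chainBlock, ← map_chainBlock, ← map_chainBlock, ← Module.End.mul_apply,
    ← Module.End.mul_apply, mul_assoc, ← toEuclideanLin_kronecker]
  simp only [Matrix.toLpLin_apply, Matrix.mulVec, dotProduct, Player.isometry]
  refine Finset.sum_congr rfl fun p _ => ?_
  simp only [Matrix.kroneckerMap_apply, swapChain_apply]

end Matrices

/-! ### From the winning probability to relations -/

section Game

variable {N : ℕ} {α β γ : Type*} [Fintype α] [DecidableEq α] [Fintype β] [DecidableEq β]
  [Fintype γ] [DecidableEq γ]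

/-- The reflection that gives the player's answer for the scored round. -/
def Player.observable (P : Player N α) : Query N → Matrix α α ℂ
  | .single i b => P.single i b
  | .pair i b j c => P.pair i b j c

lemma Player.observable_isReflection (P : Player N α) (q : Query N) :
    IsReflection (P.observable q) := by
  cases q with
  | single i b => exact P.single_isReflection i b
  | pair i b j c => exact P.pair_isReflection i b j c

lemma univ_intUnits : (Finset.univ : Finset ℤˣ) = {1, -1} := rfl

lemma Player.effect_eq (P : Player N α) (q : Query N) (a : ℤˣ) :
    P.effect q a = eigenProj (P.observable q) a := by
  cases q with
  | single i b => rfl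
  | pair i b j c =>
    have h : ∑ d : ℤˣ, eigenProj (P.pair j c i b) d = 1 := by
      rw [univ_intUnits, Finset.sum_pair (by decide)]
      simp only [eigenProj, Units.val_one, Int.cast_one, Units.val_neg, Int.cast_neg]
      module
    rw [Player.effect, ← Finset.mul_sum, h, mul_one]
    rfl

/-- Over the four sign triples of product `s`, every coefficient except those of `1` and `xyz`
averages to zero. The factors need not commute. -/
lemma sum_eigenProj_mul {A : Type*} [Ring A] [Algebra ℂ A] (x y z : A) (s : ℤˣ) :
    (∑ a : Fin 3 → ℤˣ, if a 0 * a 1 * a 2 = s then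
      ((1 / 2 : ℂ) • (1 + ((a 0 : ℤ) : ℂ) • x)) * (((1 / 2 : ℂ) • (1 + ((a 1 : ℤ) : ℂ) • y)) *
        ((1 / 2 : ℂ) • (1 + ((a 2 : ℤ) : ℂ) • z))) else 0) =
      (1 / 2 : ℂ) • (1 + ((s : ℤ) : ℂ) • (x * (y * z))) := by
  let e : (Fin 3 → ℤˣ) ≃ ℤˣ × ℤˣ × ℤˣ :=
    { toFun := fun a => (a 0, a 1, a 2)
      invFun := fun p => ![p.1, p.2.1, p.2.2]
      left_inv := fun a => by ext i; fin_cases i <;> rfl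
      right_inv := fun p => rfl }
  rw [← e.symm.sum_comp]
  have he : ∀ p i, e.symm p i = ![p.1, p.2.1, p.2.2] i := fun _ _ => rfl
  simp only [he, Fintype.sum_prod_type, univ_intUnits]
  rw [Finset.sum_pair (by decide), Finset.sum_pair (by decide), Finset.sum_pair (by decide),
    Finset.sum_pair (by decide), Finset.sum_pair (by decide), Finset.sum_pair (by decide),
    Finset.sum_pair (by decide)]
  have h1 : (1 : ℤˣ) ≠ -1 := by decide
  have h2 : (-1 : ℤˣ) ≠ 1 := by decide
  rcases Int.units_eq_one_or s with rfl | rfl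
  · simp [h2, mul_add, add_mul]
    module
  · simp [h1, mul_add, add_mul]
    module

/-- The product of the three observables on the choice `q` of the referee. -/
def Strategy.observable (S : Strategy N α β γ) (q : Choice N) :
    Module.End ℂ (EuclideanSpace ℂ (α × β × γ)) :=
  aliceHom α β γ (S.alice.observable (query q 0)) *
    (bobHom α β γ (S.bob.observable (query q 1)) *
      charlieHom α β γ (S.charlie.observable (query q 2)))

/-- The observable `T` preserves norms, so `‖T L - s L‖² = 2 - 2 s Re ⟨L, T L⟩`, which is compared
with the value `(1 + s Re ⟨L, T L⟩) / 2` of the sum. -/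
lemma Strategy.sum_answerProb (S : Strategy N α β γ) (q : Choice N) (s : ℤˣ) :
    (∑ a : Fin 3 → ℤˣ, if a 0 * a 1 * a 2 = s then S.answerProb q a else 0) =
      1 - ‖S.observable q S.state - ((s : ℤ) : ℂ) • S.state‖ ^ 2 / 4 := by
  have hpres : ‖S.observable q S.state‖ = 1 := by
    rw [Strategy.observable, ((S.alice.observable_isReflection _).preserving_alice.mul
      ((S.bob.observable_isReflection _).preserving_bob.mul
        (S.charlie.observable_isReflection _).preserving_charlie)), S.norm_state]
  have h1 := congr((inner ℂ S.state ($(sum_eigenProj_mul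
    (aliceHom α β γ (S.alice.observable (query q 0)))
    (bobHom α β γ (S.bob.observable (query q 1)))
    (charlieHom α β γ (S.charlie.observable (query q 2))) s) S.state)).re)
  have h2 : (∑ a : Fin 3 → ℤˣ, if a 0 * a 1 * a 2 = s then S.answerProb q a else 0) =
      (inner ℂ S.state (((1 / 2 : ℂ) • (1 + ((s : ℤ) : ℂ) • S.observable q)) S.state)).re := by
    rw [Strategy.observable, ← h1, LinearMap.sum_apply, inner_sum, Complex.re_sum]
    refine Finset.sum_congr rfl fun a _ => ?_
    split_ifs
    · rw [Strategy.answerProb, toEuclideanLin_kronecker]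
      simp only [Player.effect_eq, eigenProj, map_smul, map_add, map_one]
    · simp
  have h3 := norm_sub_sq (𝕜 := ℂ) (((s : ℤ) : ℂ) • S.state) (S.observable q S.state)
  rw [h2, norm_sub_rev, h3, hpres, norm_smul, S.norm_state]
  rcases Int.units_eq_one_or s with rfl | rfl
  · simp [S.norm_state]
    ring
  · simp [inner_smul_right, S.norm_state]
    ring

lemma card_choices_le : ((choices N).card : ℝ) ≤ 64 * N ^ 2 := by
  have h := Finset.card_le_univ (choices N)
  have h1 : Fintype.card (Choice N) = 64 * N ^ 2 := by
    simp [Choice]; ring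
  rw [h1] at h
  exact_mod_cast h

lemma Strategy.norm_observable_sub_le (S : Strategy N α β γ) {ε : ℝ} (h : S.winProb = 1 - ε)
    {q : Choice N} (hq : q ∈ choices N) :
    ‖S.observable q S.state - ((winningSign q.2.2.2.1 : ℤ) : ℂ) • S.state‖ ≤
      16 * N * Real.sqrt ε := by
  have hc : (0 : ℝ) < (choices N).card := by exact_mod_cast Finset.card_pos.2 ⟨q, hq⟩
  rw [Strategy.winProb, div_eq_iff hc.ne'] at h
  simp only [S.sum_answerProb, Finset.sum_sub_distrib, Finset.sum_const, nsmul_eq_mul, mul_one,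
    ← Finset.sum_div] at h
  have h1 := Finset.single_le_sum (f := fun q : Choice N =>
    ‖S.observable q S.state - ((winningSign q.2.2.2.1 : ℤ) : ℂ) • S.state‖ ^ 2)
    (fun _ _ => by positivity) hq
  have h2 : 0 ≤ ∑ q ∈ choices N,
      ‖S.observable q S.state - ((winningSign q.2.2.2.1 : ℤ) : ℂ) • S.state‖ ^ 2 := by positivity
  have hε : 0 ≤ ε := by
    by_contra hε
    nlinarith
  refine le_of_sq_le_sq ?_ (by positivity)
  rw [mul_pow, Real.sq_sqrt hε]
  -- The squared deviations sum to `4 ε` times the number of choices, at most `256 N² ε = (16 N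
  -- √ε)²`.
  have h3 := mul_le_mul_of_nonneg_right (card_choices_le (N := N)) hε
  linarith

end Game

/-! ### Relations for an actual strategy and assembly of the bound -/

section Final

set_option linter.unusedSectionVars false

variable {N : ℕ} {α β γ : Type*} [Fintype α] [DecidableEq α] [Fintype β] [DecidableEq β]
  [Fintype γ] [DecidableEq γ]

lemma winningSign_eq (a b c : Bool) : ((winningSign ![a, b, c] : ℤ) : ℂ) = inputSign a b c := by
  cases a <;> cases b <;> cases c <;> simp [winningSign, inputSign]

/-- Bounds on the deviation from the relations of the game, for the choice `r`, `i`, `j`,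
`![a, b, c]`, `d` of the referee. -/
lemma Strategy.norm_observable_sub_inputSign_le (S : Strategy N α β γ) {ε : ℝ}
    (h : S.winProb = 1 - ε) {r : Fin 4} {i j : Fin N} (hij : i ≠ j ∨ (N = 1 ∧ r = 0))
    {a b c : Bool} (habc : (a ^^ b ^^ c) = false) (d : Bool) :
    ‖S.observable (r, i, j, ![a, b, c], d) S.state - inputSign a b c • S.state‖ ≤
      16 * N * Real.sqrt ε := by
  have := S.norm_observable_sub_le h (q := (r, i, j, ![a, b, c], d))
    (by simp only [choices, Finset.mem_filter, Finset.mem_univ, true_and]; exact ⟨hij, habc⟩)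
  rwa [winningSign_eq] at this

lemma exists_ne_or_eq_one (i : Fin N) : ∃ j : Fin N, i ≠ j ∨ (N = 1 ∧ (0 : Fin 4) = 0) := by
  by_cases hN : N = 1
  · exact ⟨i, .inr ⟨hN, rfl⟩⟩
  · have : Nontrivial (Fin N) := Fin.nontrivial_iff_two_le.2 (by have := i.isLt; omega)
    obtain ⟨j, hj⟩ := exists_ne i
    exact ⟨j, .inl hj.symm⟩

variable (S : Strategy N α β γ) {ε : ℝ}

lemma Strategy.norm_single_sub_le (h : S.winProb = 1 - ε) (i : Fin N) (a b c : Bool)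
    (habc : (a ^^ b ^^ c) = false) :
    ‖aliceHom α β γ (S.alice.single i a) (bobHom α β γ (S.bob.single i b)
      (charlieHom α β γ (S.charlie.single i c) S.state)) - inputSign a b c • S.state‖ ≤
      16 * N * Real.sqrt ε := by
  -- With `r = 0` the second round is a dummy, but the choice must still lie in `choices N`, also
  -- when `N = 1`.
  obtain ⟨j, hj⟩ := exists_ne_or_eq_one i
  have := S.norm_observable_sub_inputSign_le h hj habc false
  simpa [Strategy.observable, query, Player.observable] using this

lemma Strategy.norm_pair_alice_sub_le (h : S.winProb = 1 - ε) {i j : Fin N} (hij : i ≠ j)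
    (a b c d : Bool) (habc : (a ^^ b ^^ c) = false) :
    ‖aliceHom α β γ (S.alice.pair i a j d) (bobHom α β γ (S.bob.single i b)
      (charlieHom α β γ (S.charlie.single i c) S.state)) - inputSign a b c • S.state‖ ≤
      16 * N * Real.sqrt ε := by
  have := S.norm_observable_sub_inputSign_le h (r := 1) (.inl hij) habc d
  simpa [Strategy.observable, query, Player.observable] using this

lemma Strategy.norm_pair_bob_sub_le (h : S.winProb = 1 - ε) {i j : Fin N} (hij : i ≠ j)
    (a b c d : Bool) (habc : (a ^^ b ^^ c) = false) :
    ‖aliceHom α β γ (S.alice.single i a) (bobHom α β γ (S.bob.pair i b j d)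
      (charlieHom α β γ (S.charlie.single i c) S.state)) - inputSign a b c • S.state‖ ≤
      16 * N * Real.sqrt ε := by
  have := S.norm_observable_sub_inputSign_le h (r := 2) (.inl hij) habc d
  simpa [Strategy.observable, query, Player.observable] using this

lemma Strategy.norm_pair_charlie_sub_le (h : S.winProb = 1 - ε) {i j : Fin N} (hij : i ≠ j)
    (a b c d : Bool) (habc : (a ^^ b ^^ c) = false) :
    ‖aliceHom α β γ (S.alice.single i a) (bobHom α β γ (S.bob.single i b)
      (charlieHom α β γ (S.charlie.pair i c j d) S.state)) - inputSign a b c • S.state‖ ≤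
      16 * N * Real.sqrt ε := by
  have := S.norm_observable_sub_inputSign_le h (r := 3) (.inl hij) habc d
  simpa [Strategy.observable, query, Player.observable] using this

lemma inputSign_swap₁₂ (a b c : Bool) : inputSign a b c = inputSign b a c := by
  simp [inputSign, Bool.or_comm a b]

lemma inputSign_swap₂₃ (a b c : Bool) : inputSign a b c = inputSign a c b := by
  simp [inputSign, Bool.or_assoc, Bool.or_comm b c]

lemma end_apply_rotate {E : Type*} [AddCommGroup E] [Module ℂ E] {A B C : Module.End ℂ E}
    (hAC : Commute A C) (hBC : Commute B C) (v : E) : C (A (B v)) = A (B (C v)) :=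
  congr($((hAC.mul_left hBC).eq.symm) v)

lemma xor_rotate {a b c : Bool} (h : (a ^^ b ^^ c) = false) : (b ^^ c ^^ a) = false := by
  revert h; cases a <;> cases b <;> cases c <;> simp

lemma Strategy.approxPauli_alice (h : S.winProb = 1 - ε) :
    ApproxPauli (fun i b => aliceHom α β γ (S.alice.single i b))
      (fun i b => bobHom α β γ (S.bob.single i !b) * charlieHom α β γ (S.charlie.single i true))
      S.state (8 * (16 * N * Real.sqrt ε)) :=
  approxPauli_of_relations (A := fun i b => aliceHom α β γ (S.alice.single i b))
    (B := fun i b => bobHom α β γ (S.bob.single i b))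
    (C := fun i b => charlieHom α β γ (S.charlie.single i b))
    (A₂ := fun i b j c => aliceHom α β γ (S.alice.pair i b j c)) (by positivity)
    (fun i b => (S.alice.single_isReflection i b).preserving_alice)
    (fun i b => (S.bob.single_isReflection i b).preserving_bob)
    (fun i b => (S.charlie.single_isReflection i b).preserving_charlie)
    (fun i b j c => (S.alice.pair_isReflection i b j c).preserving_alice)
    (fun i b => (S.alice.single_isReflection i b).map_mul_self _)
    (fun i b => (S.bob.single_isReflection i b).map_mul_self _)
    (fun i b => (S.charlie.single_isReflection i b).map_mul_self _)
    (fun i b j c => (S.alice.pair_isReflection i b j c).map_mul_self _)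
    (fun _ _ _ _ => commute_aliceHom_bobHom _ _) (fun _ _ _ _ => commute_aliceHom_charlieHom _ _)
    (fun _ _ _ _ => commute_bobHom_charlieHom _ _)
    (fun _ _ _ _ _ _ => commute_aliceHom_bobHom _ _)
    (fun _ _ _ _ _ _ => commute_aliceHom_charlieHom _ _)
    (fun i b j c => (S.alice.pair_commute i b j c).map _)
    (S.norm_single_sub_le h) (fun _ _ hij a b c d => S.norm_pair_alice_sub_le h hij a b c d)

lemma Strategy.approxPauli_bob (h : S.winProb = 1 - ε) :
    ApproxPauli (fun i b => bobHom α β γ (S.bob.single i b))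
      (fun i b => aliceHom α β γ (S.alice.single i !b) * charlieHom α β γ (S.charlie.single i true))
      S.state (8 * (16 * N * Real.sqrt ε)) :=
  approxPauli_of_relations (A := fun i b => bobHom α β γ (S.bob.single i b))
    (B := fun i b => aliceHom α β γ (S.alice.single i b))
    (C := fun i b => charlieHom α β γ (S.charlie.single i b))
    (A₂ := fun i b j c => bobHom α β γ (S.bob.pair i b j c)) (by positivity)
    (fun i b => (S.bob.single_isReflection i b).preserving_bob)
    (fun i b => (S.alice.single_isReflection i b).preserving_alice)
    (fun i b => (S.charlie.single_isReflection i b).preserving_charlie)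
    (fun i b j c => (S.bob.pair_isReflection i b j c).preserving_bob)
    (fun i b => (S.bob.single_isReflection i b).map_mul_self _)
    (fun i b => (S.alice.single_isReflection i b).map_mul_self _)
    (fun i b => (S.charlie.single_isReflection i b).map_mul_self _)
    (fun i b j c => (S.bob.pair_isReflection i b j c).map_mul_self _)
    (fun _ _ _ _ => (commute_aliceHom_bobHom _ _).symm)
    (fun _ _ _ _ => commute_bobHom_charlieHom _ _)
    (fun _ _ _ _ => commute_aliceHom_charlieHom _ _)
    (fun _ _ _ _ _ _ => (commute_aliceHom_bobHom _ _).symm)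
    (fun _ _ _ _ _ _ => commute_bobHom_charlieHom _ _)
    (fun i b j c => (S.bob.pair_commute i b j c).map _)
    (fun i a b c habc => by
      rw [← (commute_aliceHom_bobHom _ _).end_apply, inputSign_swap₁₂]
      exact S.norm_single_sub_le h i b a c (by rwa [Bool.xor_comm b a]))
    (fun i j hij a b c d habc => by
      rw [← (commute_aliceHom_bobHom _ _).end_apply, inputSign_swap₁₂]
      exact S.norm_pair_bob_sub_le h hij b a c d (by rwa [Bool.xor_comm b a]))

lemma Strategy.approxPauli_charlie (h : S.winProb = 1 - ε) :
    ApproxPauli (fun i b => charlieHom α β γ (S.charlie.single i b))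
      (fun i b => aliceHom α β γ (S.alice.single i !b) * bobHom α β γ (S.bob.single i true))
      S.state (8 * (16 * N * Real.sqrt ε)) :=
  approxPauli_of_relations (A := fun i b => charlieHom α β γ (S.charlie.single i b))
    (B := fun i b => aliceHom α β γ (S.alice.single i b))
    (C := fun i b => bobHom α β γ (S.bob.single i b))
    (A₂ := fun i b j c => charlieHom α β γ (S.charlie.pair i b j c)) (by positivity)
    (fun i b => (S.charlie.single_isReflection i b).preserving_charlie)
    (fun i b => (S.alice.single_isReflection i b).preserving_alice)
    (fun i b => (S.bob.single_isReflection i b).preserving_bob)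
    (fun i b j c => (S.charlie.pair_isReflection i b j c).preserving_charlie)
    (fun i b => (S.charlie.single_isReflection i b).map_mul_self _)
    (fun i b => (S.alice.single_isReflection i b).map_mul_self _)
    (fun i b => (S.bob.single_isReflection i b).map_mul_self _)
    (fun i b j c => (S.charlie.pair_isReflection i b j c).map_mul_self _)
    (fun _ _ _ _ => (commute_aliceHom_charlieHom _ _).symm)
    (fun _ _ _ _ => (commute_bobHom_charlieHom _ _).symm)
    (fun _ _ _ _ => commute_aliceHom_bobHom _ _)
    (fun _ _ _ _ _ _ => (commute_aliceHom_charlieHom _ _).symm)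
    (fun _ _ _ _ _ _ => (commute_bobHom_charlieHom _ _).symm)
    (fun i b j c => (S.charlie.pair_commute i b j c).map _)
    (fun i a b c habc => by
      have e := S.norm_single_sub_le h i b c a (xor_rotate habc)
      rw [← end_apply_rotate (commute_aliceHom_charlieHom _ _) (commute_bobHom_charlieHom _ _),
        inputSign_swap₂₃, inputSign_swap₁₂] at e
      exact e)
    (fun i j hij a b c d habc => by
      have e := S.norm_pair_charlie_sub_le h hij b c a d (xor_rotate habc)
      rw [← end_apply_rotate (commute_aliceHom_charlieHom _ _) (commute_bobHom_charlieHom _ _),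
        inputSign_swap₂₃, inputSign_swap₁₂] at e
      exact e)

lemma Strategy.approxGHZ (h : S.winProb = 1 - ε) (hN : 1 ≤ N) :
    ApproxGHZ (fun i b => aliceHom α β γ (S.alice.single i b))
      (fun i b => bobHom α β γ (S.bob.single i b))
      (fun i b => charlieHom α β γ (S.charlie.single i b)) S.state
      (40 * N ^ 2 * (8 * (16 * N * Real.sqrt ε))) := by
  have h1 : 16 * N * Real.sqrt ε ≤ 40 * N ^ 2 * (8 * (16 * N * Real.sqrt ε)) := by
    have h2 : (1 : ℝ) ≤ N := by exact_mod_cast hN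
    have h3 : 0 ≤ 16 * N * Real.sqrt ε := by positivity
    calc 16 * N * Real.sqrt ε ≤ 320 * N ^ 2 * (16 * N * Real.sqrt ε) :=
          le_mul_of_one_le_left h3 (by nlinarith)
      _ = 40 * N ^ 2 * (8 * (16 * N * Real.sqrt ε)) := by ring
  exact {
    preserving₁ := (S.approxPauli_alice h).preserving
    preserving₂ := (S.approxPauli_bob h).preserving
    preserving₃ := (S.approxPauli_charlie h).preserving
    commute₁₂ := fun _ _ _ _ => commute_aliceHom_bobHom _ _
    commute₁₃ := fun _ _ _ _ => commute_aliceHom_charlieHom _ _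
    commute₂₃ := fun _ _ _ _ => commute_bobHom_charlieHom _ _
    flip₁ := (S.approxPauli_alice h).l2norm_flip_sub_le
    flip₂ := (S.approxPauli_bob h).l2norm_flip_sub_le
    flip₃ := (S.approxPauli_charlie h).l2norm_flip_sub_le
    sign₁ := (S.approxPauli_alice h).l2norm_sign_sub_le
    sign₂ := (S.approxPauli_bob h).l2norm_sign_sub_le
    sign₃ := (S.approxPauli_charlie h).l2norm_sign_sub_le
    rel₁ := fun i => by
      simpa [inputSign] using (S.norm_single_sub_le h i false true true rfl).trans h1
    rel₂ := fun i => by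
      simpa [inputSign] using (S.norm_single_sub_le h i true false true rfl).trans h1
    rel₃ := fun i => by
      simpa [inputSign] using (S.norm_single_sub_le h i true true false rfl).trans h1 }

/-! ### The ideal state -/

/-- Since `‖w‖ = 1`, the norm of `v` is within `e` of `1`, and rescaling costs at most another `e`.
If `v = 0`, then `e ≥ 1` and any unit vector will do. -/
lemma exists_norm_one_norm_sub_le {V W : Type*} [NormedAddCommGroup V] [NormedSpace ℂ V]
    [NormedAddCommGroup W] [NormedSpace ℂ W] {G : V → W} (hG : ∀ (c : ℂ) v, G (c • v) = c • G v)
    (hG' : ∀ v, ‖G v‖ = ‖v‖) {w : W} (hw : ‖w‖ = 1) {v₀ : V} (hv₀ : ‖v₀‖ = 1) {v : V} {e : ℝ}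
    (h : ‖w - G v‖ ≤ e) : ∃ v', ‖v'‖ = 1 ∧ ‖w - G v'‖ ≤ 2 * e := by
  have h1 := abs_norm_sub_norm_le w (G v)
  rw [hw, hG'] at h1
  by_cases hv : v = 0
  · refine ⟨v₀, hv₀, ?_⟩
    have h2 := norm_sub_le w (G v₀)
    rw [hw, hG', hv₀] at h2
    rw [hv, norm_zero, sub_zero, abs_one] at h1
    rw [hv] at h
    linarith
  · have hv' : ‖v‖ ≠ 0 := norm_ne_zero_iff.2 hv
    refine ⟨((‖v‖⁻¹ : ℝ) : ℂ) • v, by simp [norm_smul, hv'], ?_⟩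
    have h3 : ‖G v - G (((‖v‖⁻¹ : ℝ) : ℂ) • v)‖ = |1 - ‖v‖| := by
      have e1 : G v - G (((‖v‖⁻¹ : ℝ) : ℂ) • v) = ((1 - ‖v‖⁻¹ : ℝ) : ℂ) • G v := by
        rw [hG]; push_cast; module
      rw [e1, norm_smul, hG', Complex.norm_real, Real.norm_eq_abs, ← abs_norm v, ← abs_mul, abs_norm,
        sub_mul, inv_mul_cancel₀ hv', one_mul, abs_sub_comm]
    have h4 := norm_sub_le_norm_sub_add_norm_sub w (G v) (G (((‖v‖⁻¹ : ℝ) : ℂ) • v))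
    linarith

/-- Separating the qubits of the three players from their own registers. -/
def registerEquiv (U α β γ : Type*) :
    (U × α) × (U × β) × (U × γ) ≃ (α × β × γ) × U × U × U where
  toFun p := ((p.1.2, p.2.1.2, p.2.2.2), p.1.1, p.2.1.1, p.2.2.1)
  invFun p := ((p.2.1, p.1.1), (p.2.2.1, p.1.2.1), (p.2.2.2, p.1.2.2))

lemma norm_eq_l2norm {U : Type*} [Fintype U] {a : U × U × U → EuclideanSpace ℂ (α × β × γ)}
    {ψ : EuclideanSpace ℂ ((U × α) × (U × β) × (U × γ))}
    (h : ∀ u v w x y z, ‖ψ ((u, x), (v, y), (w, z))‖ = ‖a (u, v, w) (x, y, z)‖) :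
    ‖ψ‖ = l2norm a := by
  refine (l2norm_eq_of_sq (norm_nonneg _) ?_).symm
  rw [EuclideanSpace.norm_sq_eq, ← (registerEquiv U α β γ).symm.sum_comp fun i => ‖ψ i‖ ^ 2,
    Fintype.sum_prod_type_right (f := fun i => ‖ψ ((registerEquiv U α β γ).symm i)‖ ^ 2)]
  refine Finset.sum_congr rfl fun p _ => ?_
  rw [EuclideanSpace.norm_sq_eq]
  exact Finset.sum_congr rfl fun q _ => by rw [← h]; rfl

lemma sum_fst_comp (f : (Fin N → Fin 2) → ℝ) :
    ∑ u : Fin N → Fin 2 × Fin 2, f (fun k => (u k).1) = 2 ^ N * ∑ b, f b := by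
  let e : (Fin N → Fin 2 × Fin 2) ≃ (Fin N → Fin 2) × (Fin N → Fin 2) :=
    Equiv.arrowProdEquivProdArrow _ _ _
  rw [← e.symm.sum_comp, Fintype.sum_prod_type]
  simp [e, Equiv.arrowProdEquivProdArrow, Finset.mul_sum]

lemma prod_stateG (u v w : Fin N → Fin 2 × Fin 2) :
    ∏ k, stateG ((u k).2, (v k).2, (w k).2) =
      tripleSign (u, v, w) / (2 * (Real.sqrt 2 : ℂ)) ^ N := by
  simp [stateG, tripleSign, labelSign, Finset.prod_div_distrib]

lemma norm_prod_stateG_sq (u v w : Fin N → Fin 2 × Fin 2) :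
    ‖∏ k, stateG ((u k).2, (v k).2, (w k).2)‖ ^ 2 = ((8 : ℝ) ^ N)⁻¹ := by
  rw [prod_stateG, norm_div, norm_tripleSign, norm_pow, div_pow, ← pow_mul, mul_comm N 2, pow_mul,
    norm_mul, Complex.norm_real, mul_pow, Real.norm_eq_abs, sq_abs, Real.sq_sqrt (by norm_num)]
  norm_num

lemma idealState_smul (c : ℂ) (L' : EuclideanSpace ℂ
      ((α × β × γ) × (Fin N → Fin 2) × (Fin N → Fin 2) × (Fin N → Fin 2))) :
    idealState N (c • L') = c • idealState N L' := by
  ext ⟨⟨u, x⟩, ⟨v, y⟩, ⟨w, z⟩⟩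
  simp [idealState]
  ring

lemma norm_idealState (L' : EuclideanSpace ℂ
      ((α × β × γ) × (Fin N → Fin 2) × (Fin N → Fin 2) × (Fin N → Fin 2))) :
    ‖idealState N L'‖ = ‖L'‖ := by
  rw [← sq_eq_sq₀ (norm_nonneg _) (norm_nonneg _), EuclideanSpace.norm_sq_eq,
    EuclideanSpace.norm_sq_eq, ← (registerEquiv _ α β γ).symm.sum_comp, Fintype.sum_prod_type,
    Fintype.sum_prod_type (f := fun i => ‖L' i‖ ^ 2)]
  refine Finset.sum_congr rfl fun p _ => ?_
  simp only [Fintype.sum_prod_type]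
  have e : ∀ u v w : Fin N → Fin 2 × Fin 2,
      ‖idealState N L' ((registerEquiv _ α β γ).symm (p, u, v, w))‖ ^ 2 =
        ((8 : ℝ) ^ N)⁻¹ * ‖L' (p, fun k => (u k).1, fun k => (v k).1, fun k => (w k).1)‖ ^ 2 := by
    intro u v w
    simp only [idealState, registerEquiv, Equiv.coe_fn_symm_mk, norm_mul, mul_pow,
      norm_prod_stateG_sq]
  simp only [e, ← Finset.mul_sum]
  rw [sum_fst_comp fun b => ∑ v : Fin N → Fin 2 × Fin 2, ∑ w : Fin N → Fin 2 × Fin 2,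
    ‖L' (p, b, fun k => (v k).1, fun k => (w k).1)‖ ^ 2]
  have e₁ : ∀ b, ∑ v : Fin N → Fin 2 × Fin 2, ∑ w : Fin N → Fin 2 × Fin 2,
      ‖L' (p, b, fun k => (v k).1, fun k => (w k).1)‖ ^ 2 =
        2 ^ N * (2 ^ N * ∑ b', ∑ b'', ‖L' (p, b, b', b'')‖ ^ 2) := fun b => by
    rw [sum_fst_comp fun b' => ∑ w : Fin N → Fin 2 × Fin 2,
      ‖L' (p, b, b', fun k => (w k).1)‖ ^ 2, Finset.mul_sum (a := (2 : ℝ) ^ N) (s := Finset.univ)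
        (f := fun b' => ∑ b'', ‖L' (p, b, b', b'')‖ ^ 2)]
    congr 1
    exact Finset.sum_congr rfl fun b' _ => sum_fst_comp fun b'' => ‖L' (p, b, b', b'')‖ ^ 2
  simp only [e₁, ← Finset.mul_sum]
  -- The `8 ^ N` labels of the qubits `Q` cancel the squared modulus `8 ^ (-N)` of each coefficient
  -- of `|G⟩^{⊗ N}`.
  have h8 : (8 : ℝ) ^ N = 2 ^ N * (2 ^ N * 2 ^ N) := by
    rw [← mul_pow, ← mul_pow]; norm_num
  rw [h8]
  field_simp

lemma norm_isometry_apply :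
    ‖Matrix.toEuclideanLin (S.alice.isometry ⊗ₖ (S.bob.isometry ⊗ₖ S.charlie.isometry)) S.state‖ =
      1 := by
  rw [norm_toEuclideanLin, S.norm_state]
  rw [Matrix.conjTranspose_kronecker, Matrix.conjTranspose_kronecker, ← Matrix.mul_kronecker_mul,
    ← Matrix.mul_kronecker_mul, isometry_conjTranspose_mul_self, isometry_conjTranspose_mul_self,
    isometry_conjTranspose_mul_self, Matrix.one_kronecker_one, Matrix.one_kronecker_one]

lemma Strategy.exists_norm_sub_idealState_le (h : S.winProb = 1 - ε) (hN : 1 ≤ N) :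
    ∃ L₀ : EuclideanSpace ℂ
        ((α × β × γ) × (Fin N → Fin 2) × (Fin N → Fin 2) × (Fin N → Fin 2)),
      ‖Matrix.toEuclideanLin
        (S.alice.isometry ⊗ₖ (S.bob.isometry ⊗ₖ S.charlie.isometry)) S.state -
          idealState N L₀‖ ≤ 12 * N * (40 * N ^ 2 * (8 * (16 * N * Real.sqrt ε))) := by
  set t := twistedBlock (fun i b => aliceHom α β γ (S.alice.single i b))
    (fun i b => bobHom α β γ (S.bob.single i b))
    (fun i b => charlieHom α β γ (S.charlie.single i b)) S.state with ht
  -- The averaged tuple depends only on the `Q̄` labels, so its values at zero `Q` labels define a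
  -- vector; the factor `(2√2)^N` undoes the normalization of `|G⟩^{⊗ N}`.
  let L₀ : EuclideanSpace ℂ
      ((α × β × γ) × (Fin N → Fin 2) × (Fin N → Fin 2) × (Fin N → Fin 2)) :=
    WithLp.toLp 2 fun p => (2 * (Real.sqrt 2 : ℂ)) ^ N *
      shiftMean t (fun k => (p.2.1 k, 0), fun k => (p.2.2.1 k, 0), fun k => (p.2.2.2 k, 0)) p.1
  refine ⟨L₀, ?_⟩
  have h1 := (S.approxGHZ h hN).l2norm_sub_shiftMean_le (by positivity)
  refine (norm_eq_l2norm fun u v w x y z => ?_).trans_le h1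
  have h2 : (2 * (Real.sqrt 2 : ℂ)) ^ N ≠ 0 := by simp
  have h3 : idealState N L₀ ((u, x), (v, y), (w, z)) =
      tripleSign (u, v, w) * shiftMean t (u, v, w) (x, y, z) := by
    simp only [idealState, L₀, prod_stateG, shiftMean_eq u v w]
    field_simp
  rw [PiLp.sub_apply, PiLp.sub_apply, toEuclideanLin_isometry_kronecker_apply, h3, ← ht, ht,
    twistedBlock, ← ht, ← one_mul ‖_ - _‖, ← norm_tripleSign (u, v, w), ← norm_mul, mul_sub,
    ← mul_assoc, tripleSign_mul_self, one_mul]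
  rfl

lemma Strategy.exists_norm_eq_one (S : Strategy N α β γ) : ∃ v : EuclideanSpace ℂ
    ((α × β × γ) × (Fin N → Fin 2) × (Fin N → Fin 2) × (Fin N → Fin 2)), ‖v‖ = 1 := by
  have : Nonempty (α × β × γ) := by
    by_contra hne
    rw [not_nonempty_iff] at hne
    have := S.norm_state
    simp [EuclideanSpace.norm_eq] at this
  exact ⟨EuclideanSpace.single (Classical.arbitrary _) 1, by simp⟩

end Final

end GHZ

end

theorem mainTheorem1 :
    ∃ K : ℝ, 0 < K ∧
      ∀ (N : ℕ), 1 ≤ N →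
      ∀ (α β γ : Type*) [Fintype α] [DecidableEq α] [Fintype β] [DecidableEq β]
        [Fintype γ] [DecidableEq γ] (S : GHZ.Strategy N α β γ) (ε : ℝ),
        S.winProb = 1 - ε →
        S.alice.isometryᴴ * S.alice.isometry = 1 ∧
        S.bob.isometryᴴ * S.bob.isometry = 1 ∧
        S.charlie.isometryᴴ * S.charlie.isometry = 1 ∧
        ∃ L' : EuclideanSpace ℂ
            ((α × β × γ) × (Fin N → Fin 2) × (Fin N → Fin 2) × (Fin N → Fin 2)),
          ‖L'‖ = 1 ∧
          ‖Matrix.toEuclideanLin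
              (S.alice.isometry ⊗ₖ (S.bob.isometry ⊗ₖ S.charlie.isometry)) S.state -
            GHZ.idealState N L'‖ ≤ K * (N : ℝ) ^ 4 * Real.sqrt ε := by
  -- `122880 = 2 · 12 · 40 · 8 · 16`: normalization, shifts, chain, Pauli relations, game.
  refine ⟨122880, by norm_num, fun N hN α β γ _ _ _ _ _ _ S ε h =>
    ⟨GHZ.isometry_conjTranspose_mul_self _, GHZ.isometry_conjTranspose_mul_self _,
      GHZ.isometry_conjTranspose_mul_self _, ?_⟩⟩
  obtain ⟨L₀, hL₀⟩ := S.exists_norm_sub_idealState_le h hN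
  obtain ⟨v₀, hv₀⟩ := S.exists_norm_eq_one
  obtain ⟨L', hL', hL''⟩ := GHZ.exists_norm_one_norm_sub_le GHZ.idealState_smul GHZ.norm_idealState
    (GHZ.norm_isometry_apply S) hv₀ hL₀
  exact ⟨L', hL', hL''.trans_eq (by ring)⟩
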